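/- Let $d\ge 1$ and $m\ge 0$ be integers and let $D\in\mathbb{R}^{(d-1)\times d}$ be the one-dimensional difference operator, $(Dz)_i=z_{i+1}-z_i$ for $1\le i\le d-1$. Let $x\in\mathbb{R}^d$ be $\ell$-cosparse with respect to $D$, i.e. exactly $\ell$ of the $d-1$ entries of $Dx$ vanish, and put $s=d-1-\ell$, the number of non-zero entries of $Dx$. Let $\tau>0$, $\eta\in\mathbb{R}$, $0<\varepsilon<1$, and let $M\in\mathbb{R}^{m\times d}$ be a Gaussian random matrix, i.e. its entries are independent standard normal random variables. If $$\frac{m^2}{m+1}\;\ge\;\left(\sqrt{d\left(1-\frac1\pi\left(1-\frac{s+1}{d}\right)^2\right)}+\sqrt{2\ln(\varepsilon^{-1})}+\tau\right)^2,$$ then with probability at least $1-\varepsilon$ on the draw of $M$ the following holds: for every noise vector $w\in\mathbb{R}^m$ with $\|w\|_2\le\eta$ and $y=Mx+w$, any minimizer $\hat x$ of $$\min_{z\in\mathbb{R}^d}\ \|Dz\|_1\quad\text{subject to}\quad \|Mz-y\|_2\le\eta$$ satisfies $$\|x-\hat x\|_2\le\frac{2\eta}{\tau}.$$ -/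

import Mathlib

open MeasureTheory ProbabilityTheory

open scoped Matrix

/-- The one-dimensional difference operator, the `(d - 1) × d` matrix with rows
`(0, …, 0, -1, 1, 0, …, 0)`, so that `(diffOperator d *ᵥ x) i = x (i + 1) - x i`. -/
def diffOperator (d : ℕ) : Matrix (Fin (d - 1)) (Fin d) ℝ :=
  Matrix.of fun i j =>
    if (j : ℕ) = (i : ℕ) then -1 else if (j : ℕ) = (i : ℕ) + 1 then 1 else 0

/-- The `ℓ₁`-norm of a vector. -/
def l1Norm {p : ℕ} (v : Fin p → ℝ) : ℝ := ∑ j, |v j|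

/-- `x` is `ℓ`-cosparse with respect to the analysis operator `A ∈ ℝ^{p × d}`: if `s` is the number
of non-zero entries of `A x`, then `ℓ = p - s`. -/
def IsCosparse {p d : ℕ} (A : Matrix (Fin p) (Fin d) ℝ) (ℓ : ℕ)
    (x : EuclideanSpace ℝ (Fin d)) : Prop :=
  ℓ + {j : Fin p | (A *ᵥ x.ofLp) j ≠ 0}.ncard = p

/-- The matrix-vector product, as a vector of Euclidean space. -/
def applyMatrix {m d : ℕ} (M : Matrix (Fin m) (Fin d) ℝ) (x : EuclideanSpace ℝ (Fin d)) :
    EuclideanSpace ℝ (Fin m) :=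
  WithLp.toLp 2 (M *ᵥ x.ofLp)

/-- The constraint set `{z : ‖M z - y‖₂ ≤ η}`. -/
def feasibleSet {m d : ℕ} (M : Matrix (Fin m) (Fin d) ℝ) (y : EuclideanSpace ℝ (Fin m)) (η : ℝ) :
    Set (EuclideanSpace ℝ (Fin d)) :=
  {z | ‖applyMatrix M z - y‖ ≤ η}

/-- `z` is a minimizer of `‖A z‖₁` subject to `‖M z - y‖₂ ≤ η`. -/
def IsAnalysisL1Minimizer {p m d : ℕ} (A : Matrix (Fin p) (Fin d) ℝ)
    (M : Matrix (Fin m) (Fin d) ℝ) (y : EuclideanSpace ℝ (Fin m)) (η : ℝ)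
    (z : EuclideanSpace ℝ (Fin d)) : Prop :=
  z ∈ feasibleSet M y η ∧
    IsMinOn (fun u : EuclideanSpace ℝ (Fin d) => l1Norm (A *ᵥ u.ofLp)) (feasibleSet M y η) z

/-- A Gaussian random matrix: the entries are independent standard normal random variables. -/
def IsGaussianMatrix {Ω : Type*} [MeasurableSpace Ω] (P : Measure Ω) {m d : ℕ}
    (M : Ω → Matrix (Fin m) (Fin d) ℝ) : Prop :=
  (∀ i j, HasLaw (fun ω => M ω i j) (gaussianReal 0 1) P) ∧
    iIndepFun (fun (ij : Fin m × Fin d) ω => M ω ij.1 ij.2) P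

namespace GaussianTools

set_option linter.unusedSectionVars false

/-- The standard Gaussian measure on `J → ℝ`. -/
noncomputable abbrev stdPi (J : Type*) [Fintype J] : Measure (J → ℝ) :=
  Measure.pi fun _ : J => gaussianReal 0 1

/-- Functions of at most exponential growth. -/
def ExpGrowth {J : Type*} [Fintype J] (f : (J → ℝ) → ℝ) : Prop :=
  ∃ C : ℝ, 0 ≤ C ∧ ∀ x, |f x| ≤ C * Real.exp (C * ‖x‖)

section Growth

variable {J I : Type*} [Fintype J] [Fintype I]

theorem ExpGrowth.of_le {f g : (J → ℝ) → ℝ} (hg : ExpGrowth g) (h : ∀ x, |f x| ≤ g x) :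
    ExpGrowth f := by
  obtain ⟨C, hC, hg⟩ := hg
  exact ⟨C, hC, fun x => (h x).trans ((le_abs_self _).trans (hg x))⟩

theorem expGrowth_of_bound {f : (J → ℝ) → ℝ} {A B : ℝ} (hA : 0 ≤ A) (hB : 0 ≤ B)
    (h : ∀ x, |f x| ≤ A * Real.exp (B * ‖x‖)) : ExpGrowth f := by
  refine ⟨A + B, by positivity, fun x => (h x).trans ?_⟩
  have := norm_nonneg x
  gcongr <;> linarith

theorem expGrowth_const (c : ℝ) : ExpGrowth fun _ : J → ℝ => c :=
  expGrowth_of_bound (abs_nonneg c) le_rfl fun x => by simp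

theorem expGrowth_of_abs_le {f : (J → ℝ) → ℝ} (c : ℝ) (h : ∀ x, |f x| ≤ c) : ExpGrowth f :=
  (expGrowth_const c).of_le h

theorem expGrowth_of_linear {f : (J → ℝ) → ℝ} {C : ℝ} (hC : 0 ≤ C)
    (h : ∀ x, |f x| ≤ C * (1 + ‖x‖)) : ExpGrowth f := by
  refine expGrowth_of_bound hC zero_le_one fun x => (h x).trans ?_
  have := Real.add_one_le_exp (1 * ‖x‖)
  gcongr
  linarith

theorem expGrowth_coord (j : J) : ExpGrowth fun x : J → ℝ => x j :=
  expGrowth_of_linear zero_le_one fun x => by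
    have := norm_le_pi_norm x j
    rw [Real.norm_eq_abs] at this
    linarith

theorem ExpGrowth.mul {f g : (J → ℝ) → ℝ} (hf : ExpGrowth f) (hg : ExpGrowth g) :
    ExpGrowth fun x => f x * g x := by
  obtain ⟨C, hC, hf⟩ := hf
  obtain ⟨D, hD, hg⟩ := hg
  refine expGrowth_of_bound (A := C * D) (B := C + D) (by positivity) (by positivity) fun x => ?_
  rw [abs_mul, add_mul, Real.exp_add]
  calc |f x| * |g x| ≤ (C * Real.exp (C * ‖x‖)) * (D * Real.exp (D * ‖x‖)) := by
        gcongr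
        exacts [hf x, hg x]
    _ = _ := by ring

theorem ExpGrowth.add {f g : (J → ℝ) → ℝ} (hf : ExpGrowth f) (hg : ExpGrowth g) :
    ExpGrowth fun x => f x + g x := by
  obtain ⟨C, hC, hf⟩ := hf
  obtain ⟨D, hD, hg⟩ := hg
  refine ⟨C + D, by positivity, fun x => (abs_add_le _ _).trans ?_⟩
  have hx := norm_nonneg x
  calc |f x| + |g x| ≤ C * Real.exp (C * ‖x‖) + D * Real.exp (D * ‖x‖) := add_le_add (hf x) (hg x)
    _ ≤ C * Real.exp ((C + D) * ‖x‖) + D * Real.exp ((C + D) * ‖x‖) := by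
        gcongr <;> linarith
    _ = _ := by ring

theorem ExpGrowth.neg {f : (J → ℝ) → ℝ} (hf : ExpGrowth f) : ExpGrowth fun x => - f x := by
  obtain ⟨C, hC, hf⟩ := hf
  exact ⟨C, hC, fun x => by rw [abs_neg]; exact hf x⟩

theorem ExpGrowth.sum {ι : Type*} (s : Finset ι) {f : ι → (J → ℝ) → ℝ}
    (hf : ∀ i ∈ s, ExpGrowth (f i)) : ExpGrowth fun x => ∑ i ∈ s, f i x := by
  classical
  induction s using Finset.induction_on with
  | empty => simpa using expGrowth_const (J := J) 0
  | insert a s ha ih =>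
    simp only [Finset.sum_insert ha]
    exact (hf a (Finset.mem_insert_self a s)).add
      (ih fun i hi => hf i (Finset.mem_insert_of_mem hi))

theorem ExpGrowth.comp_bound {f : (I → ℝ) → ℝ} (hf : ExpGrowth f) {g : (J → ℝ) → (I → ℝ)} {K : ℝ}
    (hK : 0 ≤ K) (hg : ∀ x, ‖g x‖ ≤ K * ‖x‖) : ExpGrowth fun x => f (g x) := by
  obtain ⟨C, hC, hf⟩ := hf
  refine expGrowth_of_bound (A := C) (B := C * K) hC (by positivity) fun x => (hf _).trans ?_
  rw [mul_assoc]
  gcongr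
  exact hg x

theorem integrable_exp_mul_norm (C : ℝ) : Integrable (fun x : J → ℝ => Real.exp (C * ‖x‖))
    (stdPi J) := by
  have h1 : Integrable (fun t : ℝ => Real.exp (|C| * |t|)) (gaussianReal 0 1) := by
    refine Integrable.mono' ((integrable_exp_mul_gaussianReal (|C|)).add
      (integrable_exp_mul_gaussianReal (-|C|))) (by fun_prop) (ae_of_all _ fun t => ?_)
    rw [Real.norm_eq_abs, Real.abs_exp]
    rcases abs_cases t with ⟨h, _⟩ | ⟨h, _⟩ <;> simp only [h, Pi.add_apply]
    · have := Real.exp_pos (-|C| * t)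
      linarith
    · have := Real.exp_pos (|C| * t)
      rw [mul_neg, ← neg_mul]
      linarith
  have h2 := Integrable.fintype_prod (f := fun _ : J => fun t : ℝ => Real.exp (|C| * |t|))
    (μ := fun _ : J => gaussianReal 0 1) fun _ => h1
  refine Integrable.mono' h2 (by fun_prop) (ae_of_all _ fun x => ?_)
  rw [Real.norm_eq_abs, Real.abs_exp, ← Real.exp_sum, ← Finset.mul_sum]
  gcongr
  · exact le_abs_self C
  · refine (pi_norm_le_iff_of_nonneg (by positivity)).2 fun i => ?_
    exact Finset.single_le_sum (f := fun i => |x i|) (fun _ _ => abs_nonneg _) (Finset.mem_univ i)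

theorem ExpGrowth.integrable {f : (J → ℝ) → ℝ} (hf : ExpGrowth f) (hm : Measurable f) :
    Integrable f (stdPi J) := by
  obtain ⟨C, hC, hf⟩ := hf
  exact Integrable.mono' ((integrable_exp_mul_norm C).const_mul C) hm.aestronglyMeasurable
    (ae_of_all _ hf)

end Growth

section Marginals

variable {J I : Type*} [Fintype J] [Fintype I]

theorem measurePreserving_comp_injective {e : I → J} (he : Function.Injective e) :
    MeasurePreserving (fun (x : J → ℝ) i => x (e i)) (stdPi J) (stdPi I) := by
  refine ⟨by fun_prop, ?_⟩
  have h : iIndepFun (fun (j : J) (x : J → ℝ) => x j) (stdPi J) :=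
    iIndepFun_pi (X := fun _ t => t) fun _ => aemeasurable_id
  have h2 := (iIndepFun_iff_map_fun_eq_pi_map
    fun i => (measurable_pi_apply (e i)).aemeasurable).1 (h.precomp he)
  rw [h2]
  congr 1
  funext i
  exact (measurePreserving_eval (fun _ : J => gaussianReal 0 1) (e i)).map_eq

theorem integral_comp_injective {e : I → J} (he : Function.Injective e) {f : (I → ℝ) → ℝ}
    (hf : Measurable f) : ∫ x, f (fun i => x (e i)) ∂(stdPi J) = ∫ y, f y ∂(stdPi I) := by
  rw [← (measurePreserving_comp_injective he).map_eq,
    integral_map (measurePreserving_comp_injective he).measurable.aemeasurable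
      hf.aestronglyMeasurable]

theorem integral_eval (j : J) {f : ℝ → ℝ} (hf : Measurable f) :
    ∫ x, f (x j) ∂(stdPi J) = ∫ t, f t ∂(gaussianReal 0 1) := by
  rw [← (measurePreserving_eval (fun _ : J => gaussianReal 0 1) j).map_eq,
    integral_map (measurable_pi_apply j).aemeasurable hf.aestronglyMeasurable]

theorem integral_coord (j : J) : ∫ x, x j ∂(stdPi J) = 0 := by
  rw [integral_eval j measurable_id']
  exact integral_id_gaussianReal

theorem measurePreserving_update [DecidableEq J] (j : J) :
    MeasurePreserving (fun p : (J → ℝ) × ℝ => Function.update p.1 j p.2)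
      ((stdPi J).prod (gaussianReal 0 1)) (stdPi J) := by
  have hm : Measurable (fun p : (J → ℝ) × ℝ => Function.update p.1 j p.2) := by
    refine measurable_pi_lambda _ fun i => ?_
    by_cases h : i = j
    · subst h
      simpa using measurable_snd
    · simp only [Function.update_of_ne h]
      fun_prop
  refine ⟨hm, ?_⟩
  symm
  refine Measure.pi_eq fun s hs => ?_
  rw [Measure.map_apply hm (MeasurableSet.univ_pi hs)]
  have : (fun p : (J → ℝ) × ℝ => Function.update p.1 j p.2) ⁻¹' Set.univ.pi s =
      (Set.univ.pi (Function.update s j Set.univ)) ×ˢ s j := by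
    ext p
    simp only [Set.mem_preimage, Set.mem_univ_pi, Set.mem_prod]
    constructor
    · intro h
      refine ⟨fun i => ?_, by simpa using h j⟩
      by_cases hi : i = j
      · subst hi; simp
      · simpa [hi] using h i
    · rintro ⟨h1, h2⟩ i
      by_cases hi : i = j
      · subst hi; simpa using h2
      · simpa [hi] using h1 i
  rw [this, Measure.prod_prod, Measure.pi_pi, ← Finset.mul_prod_erase _ _ (Finset.mem_univ j),
    ← Finset.mul_prod_erase (s := Finset.univ) (fun i => gaussianReal 0 1 (s i))
      (Finset.mem_univ j)]
  simp only [Function.update_self, measure_univ, one_mul]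
  rw [mul_comm]
  congr 1
  refine Finset.prod_congr rfl fun i hi => ?_
  rw [Function.update_of_ne (Finset.ne_of_mem_erase hi)]

end Marginals

section Stein

theorem hasDerivAt_gaussianPDFReal (t : ℝ) :
    HasDerivAt (gaussianPDFReal 0 1) (-(t * gaussianPDFReal 0 1 t)) t := by
  have h : gaussianPDFReal 0 1 =
      fun x => (Real.sqrt (2 * Real.pi * 1))⁻¹ * Real.exp (-(x - 0) ^ 2 / (2 * 1)) := by
    funext x; simp [gaussianPDFReal]
  have h2 : HasDerivAt (fun x : ℝ => -(x - 0) ^ 2 / (2 * 1)) (-t) t := by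
    have := ((((hasDerivAt_id t).sub_const 0).pow 2).neg).div_const (2 * 1)
    refine this.congr_deriv ?_
    simp
    ring
  rw [h]
  refine ((h2.exp).const_mul ((Real.sqrt (2 * Real.pi * 1))⁻¹)).congr_deriv ?_
  ring

theorem integral_mul_gaussianReal {u u' : ℝ → ℝ} (hu : ∀ t, HasDerivAt u (u' t) t)
    (h0 : Integrable u (gaussianReal 0 1)) (h1 : Integrable u' (gaussianReal 0 1))
    (h2 : Integrable (fun t => t * u t) (gaussianReal 0 1)) :
    ∫ t, t * u t ∂(gaussianReal 0 1) = ∫ t, u' t ∂(gaussianReal 0 1) := by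
  have key : ∀ f : ℝ → ℝ, Integrable f (gaussianReal 0 1) →
      Integrable (fun t => gaussianPDFReal 0 1 t * f t) := by
    intro f hf
    rw [gaussianReal_of_var_ne_zero 0 one_ne_zero,
      integrable_withDensity_iff_integrable_smul' (measurable_gaussianPDF 0 1)
        (ae_of_all _ fun _ => gaussianPDF_lt_top)] at hf
    simpa [toReal_gaussianPDF] using hf
  rw [integral_gaussianReal_eq_integral_smul one_ne_zero,
    integral_gaussianReal_eq_integral_smul one_ne_zero]
  simp only [smul_eq_mul]
  have := integral_mul_deriv_eq_deriv_mul_of_integrable (u := gaussianPDFReal 0 1) (v := u)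
    (u' := fun t => -(t * gaussianPDFReal 0 1 t)) (v' := u')
    (fun x _ => hasDerivAt_gaussianPDFReal x) (fun x _ => hu x) (key _ h1)
    (by
      refine (key _ h2).neg.congr (ae_of_all _ fun t => ?_)
      simp only [Pi.neg_apply, Pi.mul_apply]
      ring) (key _ h0)
  rw [this, ← integral_neg]
  refine integral_congr_ae (ae_of_all _ fun t => ?_)
  simp only
  ring

variable {J : Type*} [Fintype J] [DecidableEq J]

/-- The partial derivative in the direction of the `i`-th coordinate. -/
noncomputable def pd (i : J) (f : (J → ℝ) → ℝ) (x : J → ℝ) : ℝ := fderiv ℝ f x (Pi.single i 1)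

/-- Differentiable functions which, together with their partial derivatives, grow at most
exponentially. -/
structure Tame (f : (J → ℝ) → ℝ) : Prop where
  diff : Differentiable ℝ f
  growth : ExpGrowth f
  growth_pd : ∀ i, ExpGrowth (pd i f)

theorem measurable_pd (i : J) (f : (J → ℝ) → ℝ) : Measurable (pd i f) :=
  measurable_fderiv_apply_const ℝ f _

theorem Tame.measurable {f : (J → ℝ) → ℝ} (hf : Tame f) : Measurable f :=
  hf.diff.continuous.measurable

theorem fderiv_eq_sum_pd (f : (J → ℝ) → ℝ) (x v : J → ℝ) :
    fderiv ℝ f x v = ∑ i, v i * pd i f x := by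
  have : v = ∑ i, v i • (Pi.single i (1 : ℝ) : J → ℝ) := by
    funext k
    simp [Finset.sum_apply, Pi.single_apply]
  conv_lhs => rw [this]
  simp only [map_sum, map_smul, smul_eq_mul, pd]

/-- Gaussian integration by parts. -/
theorem integral_coord_mul {u : (J → ℝ) → ℝ} (hu : Tame u) (j : J) :
    ∫ x, x j * u x ∂(stdPi J) = ∫ x, pd j u x ∂(stdPi J) := by
  have mp := measurePreserving_update j
  have int : ∀ f : (J → ℝ) → ℝ, Measurable f → ExpGrowth f →
      Integrable (fun p : (J → ℝ) × ℝ => f (Function.update p.1 j p.2))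
        ((stdPi J).prod (gaussianReal 0 1)) := fun f hm hf =>
    (mp.integrable_comp hm.aestronglyMeasurable).2 (hf.integrable hm)
  have eq : ∀ f : (J → ℝ) → ℝ, Measurable f → ExpGrowth f → ∫ x, f x ∂(stdPi J) =
      ∫ x, ∫ t, f (Function.update x j t) ∂(gaussianReal 0 1) ∂(stdPi J) := by
    intro f hm hf
    rw [← integral_prod (fun p : (J → ℝ) × ℝ => f (Function.update p.1 j p.2)) (int f hm hf)]
    conv_lhs => rw [← mp.map_eq]
    rw [integral_map mp.measurable.aemeasurable hm.aestronglyMeasurable]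
  have hm0 := hu.measurable
  have hm1 := measurable_pd j u
  have hm2 : Measurable (fun x : J → ℝ => x j * u x) := by fun_prop
  have hg2 := (expGrowth_coord j).mul hu.growth
  rw [eq _ hm2 hg2, eq _ hm1 (hu.growth_pd j)]
  refine integral_congr_ae ?_
  filter_upwards [(int _ hm0 hu.growth).prod_right_ae, (int _ hm1 (hu.growth_pd j)).prod_right_ae,
    (int _ hm2 hg2).prod_right_ae] with x h0 h1 h2
  simp only [Function.update_self] at h2 ⊢
  refine integral_mul_gaussianReal (fun t => ?_) h0 h1 h2
  exact (hu.diff (Function.update x j t)).hasFDerivAt.comp_hasDerivAt t (hasDerivAt_update x j t)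

end Stein

section TameAlgebra

variable {J I : Type*} [Fintype J] [DecidableEq J] [Fintype I] [DecidableEq I]

theorem pd_const (i : J) (c : ℝ) (x : J → ℝ) : pd i (fun _ => c) x = 0 := by
  simp [pd]

theorem pd_mul {f g : (J → ℝ) → ℝ} (hf : Differentiable ℝ f) (hg : Differentiable ℝ g) (i : J)
    (x : J → ℝ) : pd i (fun y => f y * g y) x = pd i f x * g x + f x * pd i g x := by
  simp only [pd]
  rw [((hf x).hasFDerivAt.fun_mul (hg x).hasFDerivAt).fderiv]
  simp
  ring

theorem pd_add {f g : (J → ℝ) → ℝ} (hf : Differentiable ℝ f) (hg : Differentiable ℝ g) (i : J)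
    (x : J → ℝ) : pd i (fun y => f y + g y) x = pd i f x + pd i g x := by
  simp only [pd]
  rw [((hf x).hasFDerivAt.fun_add (hg x).hasFDerivAt).fderiv]
  simp

theorem pd_comp {h h' : ℝ → ℝ} {f : (J → ℝ) → ℝ} {x : J → ℝ} (hh : HasDerivAt h (h' (f x)) (f x))
    (hf : DifferentiableAt ℝ f x) (i : J) : pd i (fun y => h (f y)) x = h' (f x) * pd i f x := by
  simp only [pd]
  have : HasFDerivAt (fun y => h (f y)) _ x := hh.comp_hasFDerivAt x hf.hasFDerivAt
  rw [this.fderiv]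
  simp

theorem pd_coord (i j : J) (x : J → ℝ) : pd i (fun y => y j) x = if j = i then 1 else 0 := by
  simp only [pd]
  have : HasFDerivAt (fun y : J → ℝ => y j) (ContinuousLinearMap.proj j : (J → ℝ) →L[ℝ] ℝ) x :=
    (ContinuousLinearMap.proj j : (J → ℝ) →L[ℝ] ℝ).hasFDerivAt
  rw [this.fderiv]
  simp [Pi.single_apply]

theorem tame_const (c : ℝ) : Tame fun _ : J → ℝ => c where
  diff := by fun_prop
  growth := expGrowth_const c
  growth_pd i := expGrowth_of_abs_le 0 fun x => by simp [pd_const]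

theorem tame_coord (j : J) : Tame fun x : J → ℝ => x j where
  diff := by fun_prop
  growth := expGrowth_coord j
  growth_pd i := expGrowth_of_abs_le 1 fun x => by
    rw [pd_coord]
    split_ifs <;> simp

theorem Tame.mul {f g : (J → ℝ) → ℝ} (hf : Tame f) (hg : Tame g) : Tame fun x => f x * g x where
  diff := hf.diff.mul hg.diff
  growth := hf.growth.mul hg.growth
  growth_pd i := by
    have : pd i (fun y => f y * g y) = fun x => pd i f x * g x + f x * pd i g x :=
      funext (pd_mul hf.diff hg.diff i)
    rw [this]
    exact ((hf.growth_pd i).mul hg.growth).add (hf.growth.mul (hg.growth_pd i))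

theorem Tame.add {f g : (J → ℝ) → ℝ} (hf : Tame f) (hg : Tame g) : Tame fun x => f x + g x where
  diff := hf.diff.add hg.diff
  growth := hf.growth.add hg.growth
  growth_pd i := by
    have : pd i (fun y => f y + g y) = fun x => pd i f x + pd i g x :=
      funext (pd_add hf.diff hg.diff i)
    rw [this]
    exact (hf.growth_pd i).add (hg.growth_pd i)

theorem Tame.sum {ι : Type*} (s : Finset ι) {f : ι → (J → ℝ) → ℝ} (hf : ∀ i ∈ s, Tame (f i)) :
    Tame fun x => ∑ i ∈ s, f i x := by
  classical
  induction s using Finset.induction_on with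
  | empty => simpa using tame_const (J := J) 0
  | insert a s ha ih =>
    simp only [Finset.sum_insert ha]
    exact (hf a (Finset.mem_insert_self a s)).add
      (ih fun i hi => hf i (Finset.mem_insert_of_mem hi))

theorem norm_mulVec_le {A : Matrix I J ℝ} {K : ℝ} (hA : ∀ i j, |A i j| ≤ K) (hK : 0 ≤ K)
    (x : J → ℝ) : ‖A *ᵥ x‖ ≤ Fintype.card J * K * ‖x‖ := by
  refine (pi_norm_le_iff_of_nonneg (by positivity)).2 fun i => ?_
  rw [Matrix.mulVec, dotProduct, Real.norm_eq_abs]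
  calc |∑ j, A i j * x j| ≤ ∑ j, |A i j * x j| := Finset.abs_sum_le_sum_abs _ _
    _ ≤ ∑ _j : J, K * ‖x‖ := Finset.sum_le_sum fun j _ => by
        rw [abs_mul]
        gcongr
        exacts [hA i j, norm_le_pi_norm x j]
    _ = _ := by simp [mul_assoc]

theorem exists_entry_bound (A : Matrix I J ℝ) : ∃ K : ℝ, 0 ≤ K ∧ ∀ i j, |A i j| ≤ K := by
  refine ⟨∑ i, ∑ j, |A i j|, by positivity, fun i j => ?_⟩
  refine (Finset.single_le_sum (f := fun j => |A i j|) (fun _ _ => abs_nonneg _)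
    (Finset.mem_univ j)).trans ?_
  exact Finset.single_le_sum (f := fun i => ∑ j, |A i j|) (fun _ _ => by positivity)
    (Finset.mem_univ i)

theorem ExpGrowth.comp_mulVec {g : (I → ℝ) → ℝ} (hg : ExpGrowth g) (A : Matrix I J ℝ) :
    ExpGrowth fun x => g (A *ᵥ x) := by
  obtain ⟨K, hK, hA⟩ := exists_entry_bound A
  exact hg.comp_bound (by positivity) (norm_mulVec_le hA hK)

theorem hasFDerivAt_mulVec (A : Matrix I J ℝ) (x : J → ℝ) :
    HasFDerivAt (fun y => A *ᵥ y) (LinearMap.toContinuousLinearMap A.mulVecLin) x :=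
  (LinearMap.toContinuousLinearMap A.mulVecLin).hasFDerivAt

theorem pd_comp_mulVec {g : (I → ℝ) → ℝ} (hg : Differentiable ℝ g) (A : Matrix I J ℝ) (j : J)
    (x : J → ℝ) : pd j (fun y => g (A *ᵥ y)) x = ∑ i, A i j * pd i g (A *ᵥ x) := by
  have : HasFDerivAt (fun y => g (A *ᵥ y)) _ x :=
    (hg (A *ᵥ x)).hasFDerivAt.comp x (hasFDerivAt_mulVec A x)
  rw [pd, this.fderiv]
  simp only [ContinuousLinearMap.comp_apply, LinearMap.coe_toContinuousLinearMap',
    Matrix.mulVecLin_apply]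
  rw [fderiv_eq_sum_pd]
  simp

theorem Tame.comp_mulVec {g : (I → ℝ) → ℝ} (hg : Tame g) (A : Matrix I J ℝ) :
    Tame fun x => g (A *ᵥ x) where
  diff x := ((hg.diff (A *ᵥ x)).hasFDerivAt.comp x (hasFDerivAt_mulVec A x)).differentiableAt
  growth := hg.growth.comp_mulVec A
  growth_pd j := by
    rw [funext (pd_comp_mulVec hg.diff A j)]
    exact ExpGrowth.sum _ fun i _ => (expGrowth_const _).mul ((hg.growth_pd i).comp_mulVec A)

end TameAlgebra

section Interpolation

variable {J I : Type*} [Fintype J] [DecidableEq J] [Fintype I] [DecidableEq I]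

/-- Differentiation of `E[w(ξ) g(a θ ξ)]` along a path `a` of matrices, `ξ` standard Gaussian. -/
theorem hasDerivAt_gaussian_interpolation {w : (J → ℝ) → ℝ} {g : (I → ℝ) → ℝ} (hw : Tame w)
    (hg : Tame g) (hg2 : ∀ i, Tame (pd i g)) {a a' : ℝ → Matrix I J ℝ} {K : ℝ}
    (ha : ∀ θ i j, HasDerivAt (fun t => a t i j) (a' θ i j) θ) (hK : 0 ≤ K)
    (hKa : ∀ θ i j, |a θ i j| ≤ K) (hKa' : ∀ θ i j, |a' θ i j| ≤ K) (θ : ℝ) :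
    HasDerivAt (fun t => ∫ x, w x * g (a t *ᵥ x) ∂(stdPi J))
      (∑ i, ∑ j, a' θ i j * ∫ x, (pd j w x * pd i g (a θ *ᵥ x) +
        w x * ∑ i', a θ i' j * pd i' (pd i g) (a θ *ᵥ x)) ∂(stdPi J)) θ := by
  set K' : ℝ := Fintype.card J * K with hK'
  have hK'0 : 0 ≤ K' := by positivity
  obtain ⟨Cw, hCw, hw1⟩ := hw.growth
  choose C hC hg1 using fun i => (hg2 i).growth
  have hcont : Continuous w := hw.diff.continuous
  have hgc : Continuous g := hg.diff.continuous
  have hg2c : ∀ i, Continuous (pd i g) := fun i => (hg2 i).diff.continuous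
  have hmv : ∀ A : Matrix I J ℝ, Continuous fun x : J → ℝ => A *ᵥ x := fun A => by fun_prop
  have hB : ExpGrowth fun x : J → ℝ => Cw * Real.exp (Cw * ‖x‖) *
      ∑ i, (K' * ‖x‖) * (C i * Real.exp (C i * (K' * ‖x‖))) := by
    refine ExpGrowth.mul (expGrowth_of_bound hCw hCw fun x => ?_) (ExpGrowth.sum _ fun i _ => ?_)
    · rw [abs_of_nonneg (by positivity)]
    · refine ExpGrowth.mul (expGrowth_of_linear hK'0 fun x => ?_)
        (expGrowth_of_bound (hC i) (mul_nonneg (hC i) hK'0) fun x => ?_)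
      · rw [abs_of_nonneg (by positivity)]
        gcongr
        linarith
      · rw [abs_of_nonneg (mul_nonneg (hC i) (Real.exp_pos _).le), ← mul_assoc (C i) K' ‖x‖]
  have main := hasDerivAt_integral_of_dominated_loc_of_deriv_le (μ := stdPi J) (x₀ := θ)
    (F := fun t x => w x * g (a t *ᵥ x))
    (F' := fun t x => w x * ∑ i, (a' t *ᵥ x) i * pd i g (a t *ᵥ x))
    (bound := fun x => Cw * Real.exp (Cw * ‖x‖) *
      ∑ i, (K' * ‖x‖) * (C i * Real.exp (C i * (K' * ‖x‖)))) (s := Set.univ) Filter.univ_mem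
    (Filter.Eventually.of_forall fun t =>
      (hcont.mul (hgc.comp (hmv _))).aestronglyMeasurable)
    ((hw.mul (hg.comp_mulVec (a θ))).growth.integrable (hw.mul (hg.comp_mulVec (a θ))).measurable)
    (by
      refine Continuous.aestronglyMeasurable ?_
      refine hcont.mul (continuous_finsetSum _ fun i _ => ?_)
      exact ((continuous_apply i).comp (hmv _)).mul ((hg2c i).comp (hmv _)))
    (ae_of_all _ fun x t _ => by
      rw [Real.norm_eq_abs, abs_mul]
      gcongr
      · exact hw1 x
      · refine (Finset.abs_sum_le_sum_abs _ _).trans (Finset.sum_le_sum fun i _ => ?_)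
        rw [abs_mul]
        gcongr
        · exact (norm_le_pi_norm (a' t *ᵥ x) i).trans (norm_mulVec_le (hKa' t) hK x)
        · refine (hg1 i _).trans ?_
          have := hC i
          gcongr
          exact norm_mulVec_le (hKa t) hK x)
    (hB.integrable (by fun_prop))
    (ae_of_all _ fun x t _ => by
      refine HasDerivAt.const_mul _ ?_
      have h1 : HasDerivAt (fun t => a t *ᵥ x) (a' t *ᵥ x) t := by
        refine hasDerivAt_pi.2 fun i => ?_
        simp only [Matrix.mulVec, dotProduct]
        exact HasDerivAt.fun_sum fun j _ => (ha t i j).mul_const (x j)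
      have h2 := (hg.diff (a t *ᵥ x)).hasFDerivAt.comp_hasDerivAt t h1
      rw [fderiv_eq_sum_pd] at h2
      exact h2)
  refine main.2.congr_deriv ?_
  have hT : ∀ i, Tame fun x => w x * pd i g (a θ *ᵥ x) := fun i =>
    hw.mul ((hg2 i).comp_mulVec (a θ))
  have hexp : ∀ x : J → ℝ, w x * ∑ i, (a' θ *ᵥ x) i * pd i g (a θ *ᵥ x) =
      ∑ i, ∑ j, a' θ i j * (x j * (w x * pd i g (a θ *ᵥ x))) := by
    intro x
    rw [Finset.mul_sum]
    refine Finset.sum_congr rfl fun i _ => ?_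
    rw [Matrix.mulVec, dotProduct, Finset.sum_mul, Finset.mul_sum]
    exact Finset.sum_congr rfl fun j _ => by ring
  have hint : ∀ i j, Integrable (fun x => x j * (w x * pd i g (a θ *ᵥ x))) (stdPi J) := fun i j =>
    ((tame_coord j).mul (hT i)).growth.integrable ((tame_coord j).mul (hT i)).measurable
  simp only [hexp]
  refine (integral_finsetSum _ fun i _ =>
    integrable_finsetSum _ fun j _ => (hint i j).const_mul _).trans ?_
  refine Finset.sum_congr rfl fun i _ => ?_
  refine (integral_finsetSum _ fun j _ => (hint i j).const_mul _).trans ?_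
  refine Finset.sum_congr rfl fun j _ => ?_
  rw [integral_const_mul, integral_coord_mul (hT i) j]
  congr 1
  refine integral_congr_ae (ae_of_all _ fun x => ?_)
  simp only
  rw [pd_mul hw.diff ((hg2 i).comp_mulVec (a θ)).diff, pd_comp_mulVec (hg2 i).diff]

end Interpolation

section Rotation

variable {J I : Type*} [Fintype J] [DecidableEq J] [Fintype I] [DecidableEq I]

/-- The path `cos θ A + sin θ B`. -/
noncomputable def rot (A B : Matrix I J ℝ) (θ : ℝ) : Matrix I J ℝ :=
  Real.cos θ • A + Real.sin θ • B

/-- The derivative of `rot A B`. -/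
noncomputable def rotDeriv (A B : Matrix I J ℝ) (θ : ℝ) : Matrix I J ℝ :=
  (-Real.sin θ) • A + Real.cos θ • B

theorem rot_zero (A B : Matrix I J ℝ) : rot A B 0 = A := by simp [rot]

theorem rot_pi_div_two (A B : Matrix I J ℝ) : rot A B (Real.pi / 2) = B := by simp [rot]

/-- Differentiation of `E[w(ξ) g((cos θ A + sin θ B) ξ)]`. -/
theorem hasDerivAt_integral_rot {w : (J → ℝ) → ℝ} {g : (I → ℝ) → ℝ} (hw : Tame w)
    (hg : Tame g) (hg2 : ∀ i, Tame (pd i g)) (A B : Matrix I J ℝ) (θ : ℝ) :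
    HasDerivAt (fun t => ∫ x, w x * g (rot A B t *ᵥ x) ∂(stdPi J))
      (∫ x, (∑ i, (∑ j, rotDeriv A B θ i j * pd j w x) * pd i g (rot A B θ *ᵥ x) +
        w x * ∑ i, ∑ i', (∑ j, rotDeriv A B θ i j * rot A B θ i' j) *
          pd i' (pd i g) (rot A B θ *ᵥ x)) ∂(stdPi J)) θ := by
  obtain ⟨K, hK, hA⟩ := exists_entry_bound A
  obtain ⟨L, hL, hB⟩ := exists_entry_bound B
  have bound : ∀ (c s : ℝ) (i : I) (j : J), |c| ≤ 1 → |s| ≤ 1 →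
      |(c • A + s • B) i j| ≤ K + L := by
    intro c s i j hc hs
    simp only [Matrix.add_apply, Matrix.smul_apply, smul_eq_mul]
    refine (abs_add_le _ _).trans (add_le_add ?_ ?_)
    · rw [abs_mul]
      calc |c| * |A i j| ≤ 1 * K := mul_le_mul hc (hA i j) (abs_nonneg _) zero_le_one
        _ = K := one_mul _
    · rw [abs_mul]
      calc |s| * |B i j| ≤ 1 * L := mul_le_mul hs (hB i j) (abs_nonneg _) zero_le_one
        _ = L := one_mul _
  have main := hasDerivAt_gaussian_interpolation hw hg hg2 (a := rot A B) (a' := rotDeriv A B)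
    (K := K + L) (fun t i j => by
      simp only [rot, rotDeriv, Matrix.add_apply, Matrix.smul_apply, smul_eq_mul]
      exact ((Real.hasDerivAt_cos t).mul_const _).add ((Real.hasDerivAt_sin t).mul_const _))
    (by positivity)
    (fun t i j => bound _ _ i j (Real.abs_cos_le_one t) (Real.abs_sin_le_one t))
    (fun t i j => bound _ _ i j (by rw [abs_neg]; exact Real.abs_sin_le_one t)
      (Real.abs_cos_le_one t)) θ
  refine main.congr_deriv ?_
  set a := rot A B θ
  set a' := rotDeriv A B θ
  have h1 : ∀ i j, Integrable (fun x => pd j w x * pd i g (a *ᵥ x)) (stdPi J) := fun i j =>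
    ((hw.growth_pd j).mul ((hg2 i).comp_mulVec a).growth).integrable
      ((measurable_pd j w).mul ((hg2 i).comp_mulVec a).measurable)
  have hmm : ∀ i i', Measurable fun x => pd i' (pd i g) (a *ᵥ x) := fun i i' =>
    (measurable_pd i' (pd i g)).comp (by fun_prop)
  have h2 : ∀ i j, Integrable (fun x => w x * ∑ i', a i' j * pd i' (pd i g) (a *ᵥ x))
      (stdPi J) := by
    intro i j
    refine (hw.growth.mul (ExpGrowth.sum _ fun i' _ => (expGrowth_const _).mul
      (((hg2 i).growth_pd i').comp_mulVec a))).integrable (hw.measurable.mul ?_)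
    exact Finset.measurable_fun_sum _ fun i' _ => (hmm i i').const_mul _
  have h3 : ∀ i j, Integrable (fun x => a' i j * (pd j w x * pd i g (a *ᵥ x) +
      w x * ∑ i', a i' j * pd i' (pd i g) (a *ᵥ x))) (stdPi J) := fun i j =>
    ((h1 i j).add (h2 i j)).const_mul _
  have h4 := (integral_finsetSum Finset.univ fun i _ =>
    integrable_finsetSum Finset.univ fun j _ => h3 i j).symm
  have h5 : ∀ i, _ := fun i => (integral_finsetSum Finset.univ fun j _ => h3 i j)
  simp only [h5, integral_const_mul] at h4
  refine h4.trans (integral_congr_ae (ae_of_all _ fun x => ?_))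
  simp only [mul_add, Finset.sum_add_distrib]
  congr 1
  · refine Finset.sum_congr rfl fun i _ => ?_
    rw [Finset.sum_mul]
    exact Finset.sum_congr rfl fun j _ => by ring
  · rw [Finset.mul_sum]
    refine Finset.sum_congr rfl fun i _ => ?_
    simp only [Finset.mul_sum, Finset.sum_mul]
    rw [Finset.sum_comm]
    exact Finset.sum_congr rfl fun i' _ => Finset.sum_congr rfl fun j _ => by ring

/-- Comparison of two Gaussian processes `A ξ` and `B ξ` which are independent of each other. -/
theorem integral_gaussian_comparison {g : (I → ℝ) → ℝ} (hg : Tame g) (hg2 : ∀ i, Tame (pd i g))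
    {A B : Matrix I J ℝ} (hAB : ∀ i i' j, A i j * B i' j = 0)
    (hneg : ∀ V, ∑ i, ∑ i', (∑ j, (B i j * B i' j - A i j * A i' j)) * pd i' (pd i g) V ≤ 0) :
    ∫ x, g (B *ᵥ x) ∂(stdPi J) ≤ ∫ x, g (A *ᵥ x) ∂(stdPi J) := by
  have hd := hasDerivAt_integral_rot (tame_const (J := J) 1) hg hg2 A B
  have hcoef : ∀ θ i i', ∑ j, rotDeriv A B θ i j * rot A B θ i' j =
      Real.sin θ * Real.cos θ * ∑ j, (B i j * B i' j - A i j * A i' j) := by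
    intro θ i i'
    rw [Finset.mul_sum]
    refine Finset.sum_congr rfl fun j _ => ?_
    simp only [rot, rotDeriv, Matrix.add_apply, Matrix.smul_apply, smul_eq_mul]
    linear_combination (-Real.sin θ ^ 2) * hAB i i' j + Real.cos θ ^ 2 * hAB i' i j
  have hanti : AntitoneOn (fun t => ∫ x, (fun _ => (1 : ℝ)) x * g (rot A B t *ᵥ x) ∂(stdPi J))
      (Set.Icc 0 (Real.pi / 2)) := by
    refine antitoneOn_of_deriv_nonpos (convex_Icc _ _)
      (fun θ _ => (hd θ).continuousAt.continuousWithinAt)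
      (fun θ _ => (hd θ).differentiableAt.differentiableWithinAt) fun θ hθ => ?_
    rw [interior_Icc] at hθ
    rw [(hd θ).deriv]
    refine integral_nonpos fun x => ?_
    have hs := Real.sin_nonneg_of_nonneg_of_le_pi hθ.1.le (by linarith [hθ.2, Real.pi_pos])
    have hc := Real.cos_nonneg_of_neg_pi_div_two_le_of_le (by linarith [hθ.1, Real.pi_pos]) hθ.2.le
    have h := hneg (rot A B θ *ᵥ x)
    simp only [hcoef, pd_const, mul_zero, Finset.sum_const_zero, zero_mul, one_mul, zero_add,
      Pi.zero_apply, mul_assoc (Real.sin θ * Real.cos θ), ← Finset.mul_sum]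
    exact mul_nonpos_of_nonneg_of_nonpos (mul_nonneg hs hc) h
  have h := hanti (Set.left_mem_Icc.2 (by positivity)) (Set.right_mem_Icc.2 (by positivity))
    (by positivity)
  simpa [rot_zero, rot_pi_div_two] using h

end Rotation

section Concentration

variable {ι : Type*} [Fintype ι] [DecidableEq ι]

theorem integral_mul_of_sum {f h : (ι → ℝ) → ℝ} :
    ∫ x, f (fun i => x (Sum.inl i)) * h (fun i => x (Sum.inr i)) ∂(stdPi (ι ⊕ ι)) =
      (∫ x, f x ∂(stdPi ι)) * ∫ x, h x ∂(stdPi ι) := by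
  rw [← integral_prod_mul]
  exact (measurePreserving_sumPiEquivProdPi fun _ : ι ⊕ ι => gaussianReal 0 1).integral_comp'
    fun p => f p.1 * h p.2

theorem fromCols_one_zero_mulVec (x : ι ⊕ ι → ℝ) :
    (Matrix.fromCols 1 0 : Matrix ι (ι ⊕ ι) ℝ) *ᵥ x = fun i => x (Sum.inl i) := by
  rw [Matrix.fromCols_mulVec]
  simp
  rfl

theorem fromCols_zero_one_mulVec (x : ι ⊕ ι → ℝ) :
    (Matrix.fromCols 0 1 : Matrix ι (ι ⊕ ι) ℝ) *ᵥ x = fun i => x (Sum.inr i) := by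
  rw [Matrix.fromCols_mulVec]
  simp
  rfl

theorem sum_rotDeriv_mul_rot (θ : ℝ) (i i' : ι) :
    ∑ j, rotDeriv (Matrix.fromCols 1 0 : Matrix ι (ι ⊕ ι) ℝ) (Matrix.fromCols 0 1) θ i j *
      rot (Matrix.fromCols 1 0) (Matrix.fromCols 0 1) θ i' j = 0 := by
  rw [Fintype.sum_sum_type]
  simp only [rot, rotDeriv, Matrix.add_apply, Matrix.smul_apply, smul_eq_mul,
    Matrix.fromCols_apply_inl, Matrix.fromCols_apply_inr, Matrix.zero_apply, mul_zero, add_zero,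
    zero_add]
  rw [← Finset.sum_add_distrib]
  exact Finset.sum_eq_zero fun j _ => by ring

/-- Rotation invariance of the standard Gaussian measure. -/
theorem integral_rot {g : (ι → ℝ) → ℝ} (hg : Tame g) (hg2 : ∀ i, Tame (pd i g)) (θ : ℝ) :
    ∫ x, g (rot (Matrix.fromCols 1 0) (Matrix.fromCols 0 1) θ *ᵥ x) ∂(stdPi (ι ⊕ ι)) =
      ∫ x, g x ∂(stdPi ι) := by
  have hd := hasDerivAt_integral_rot (tame_const (J := ι ⊕ ι) 1) hg hg2
    (Matrix.fromCols 1 0) (Matrix.fromCols 0 1)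
  have h := is_const_of_deriv_eq_zero (fun θ => (hd θ).differentiableAt) (fun θ => by
    rw [(hd θ).deriv]
    simp only [sum_rotDeriv_mul_rot]
    simp [pd_const]) θ 0
  simp only [one_mul, rot_zero, fromCols_one_zero_mulVec] at h
  rw [h, integral_comp_injective Sum.inl_injective hg.measurable]

theorem integral_mul_le_of_gradient {f g : (ι → ℝ) → ℝ} (hf : Tame f) (hg : Tame g)
    (hg2 : ∀ i, Tame (pd i g)) {c : ℝ}
    (h : ∀ x y, ∑ i, pd i f x * pd i g y ≤ c * g y) :
    ∫ x, f x * g x ∂(stdPi ι) ≤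
      (∫ x, f x ∂(stdPi ι)) * (∫ x, g x ∂(stdPi ι)) + c * ∫ x, g x ∂(stdPi ι) := by
  set A : Matrix ι (ι ⊕ ι) ℝ := Matrix.fromCols 1 0 with hA
  set B : Matrix ι (ι ⊕ ι) ℝ := Matrix.fromCols 0 1 with hB
  set Z : ℝ := ∫ x, g x ∂(stdPi ι) with hZ
  have hw : Tame fun x => f (A *ᵥ x) := hf.comp_mulVec A
  have hd := hasDerivAt_integral_rot hw hg hg2 A B
  have hgrad : ∀ θ x i, ∑ j, rotDeriv A B θ i j * pd j (fun y => f (A *ᵥ y)) x =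
      -Real.sin θ * pd i f (A *ᵥ x) := by
    intro θ x i
    simp only [pd_comp_mulVec hf.diff]
    rw [Fintype.sum_sum_type]
    simp [rotDeriv, hA, hB, Matrix.one_apply]
  have hmono : MonotoneOn (fun t => (∫ x, f (A *ᵥ x) * g (rot A B t *ᵥ x) ∂(stdPi (ι ⊕ ι))) -
      c * Z * Real.cos t) (Set.Icc 0 (Real.pi / 2)) := by
    have hd' := fun θ => (hd θ).sub ((Real.hasDerivAt_cos θ).const_mul (c * Z))
    refine monotoneOn_of_deriv_nonneg (convex_Icc _ _)
      (fun θ _ => (hd' θ).continuousAt.continuousWithinAt)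
      (fun θ _ => (hd' θ).differentiableAt.differentiableWithinAt) fun θ hθ => ?_
    rw [interior_Icc] at hθ
    have hs := Real.sin_nonneg_of_nonneg_of_le_pi hθ.1.le (by linarith [hθ.2, Real.pi_pos])
    have hderiv := (hd' θ).deriv
    refine le_of_le_of_eq ?_ hderiv.symm
    have hrot : ∀ i i', ∑ j, rotDeriv A B θ i j * rot A B θ i' j = 0 := sum_rotDeriv_mul_rot θ
    simp only [hgrad, hrot, zero_mul, Finset.sum_const_zero, mul_zero,
      add_zero]
    rw [← integral_rot hg hg2 θ, ← hA, ← hB] at hZ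
    have hTi : ∀ i, Integrable (fun x => -Real.sin θ * pd i f (A *ᵥ x) *
        pd i g (rot A B θ *ᵥ x)) (stdPi (ι ⊕ ι)) := fun i =>
      (((expGrowth_const _).mul ((hf.growth_pd i).comp_mulVec A)).mul
        ((hg2 i).comp_mulVec _).growth).integrable
        (((((measurable_pd i f).comp (by fun_prop))).const_mul _).mul
          ((hg2 i).comp_mulVec _).measurable)
    have hle : ∫ x, -Real.sin θ * c * g (rot A B θ *ᵥ x) ∂(stdPi (ι ⊕ ι)) ≤
        ∫ x, ∑ i, -Real.sin θ * pd i f (A *ᵥ x) * pd i g (rot A B θ *ᵥ x) ∂(stdPi (ι ⊕ ι)) := by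
      refine integral_mono (((hg.comp_mulVec _).growth.integrable
        (hg.comp_mulVec _).measurable).const_mul _) (integrable_finsetSum _ fun i _ => hTi i)
        fun x => ?_
      simp only [mul_assoc, ← Finset.mul_sum]
      have := mul_le_mul_of_nonneg_left (h (A *ᵥ x) (rot A B θ *ᵥ x)) hs
      linarith
    rw [integral_const_mul, ← hZ] at hle
    linarith
  have key := hmono (Set.left_mem_Icc.2 (by positivity)) (Set.right_mem_Icc.2 (by positivity))
    (by positivity)
  simp only [rot_zero, rot_pi_div_two, Real.cos_zero, Real.cos_pi_div_two, mul_zero, sub_zero,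
    mul_one, hA, hB, fromCols_one_zero_mulVec, fromCols_zero_one_mulVec] at key
  rw [integral_mul_of_sum, integral_comp_injective (e := Sum.inl) Sum.inl_injective
    (f := fun x => f x * g x) (hf.mul hg).measurable] at key
  linarith

theorem exists_linear_bound {f : (ι → ℝ) → ℝ} (hf : Differentiable ℝ f)
    (hgrad : ∀ x, ∑ i, pd i f x ^ 2 ≤ 1) : ∃ C, 0 ≤ C ∧ ∀ x, |f x| ≤ C * (1 + ‖x‖) := by
  have h1 : ∀ x, ‖fderiv ℝ f x‖ ≤ Fintype.card ι := by
    intro x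
    refine ContinuousLinearMap.opNorm_le_bound _ (by positivity) fun v => ?_
    rw [fderiv_eq_sum_pd, Real.norm_eq_abs]
    refine (Finset.abs_sum_le_sum_abs _ _).trans ?_
    calc ∑ i, |v i * pd i f x| ≤ ∑ _i : ι, ‖v‖ := Finset.sum_le_sum fun i _ => by
          rw [abs_mul]
          have h2 : |pd i f x| ≤ 1 := by
            rw [← sq_le_one_iff_abs_le_one]
            exact (Finset.single_le_sum (f := fun i => pd i f x ^ 2) (fun _ _ => sq_nonneg _)
              (Finset.mem_univ i)).trans (hgrad x)
          exact (mul_le_of_le_one_right (abs_nonneg _) h2).trans (norm_le_pi_norm v i)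
      _ = _ := by simp
  refine ⟨|f 0| + Fintype.card ι, by positivity, fun x => ?_⟩
  have h2 := convex_univ.norm_image_sub_le_of_norm_fderiv_le (f := f) (𝕜 := ℝ)
    (fun y _ => hf y) (fun y _ => h1 y) (Set.mem_univ 0) (Set.mem_univ x)
  rw [sub_zero, Real.norm_eq_abs] at h2
  have h3 := abs_sub_abs_le_abs_sub (f x) (f 0)
  have h4 := mul_nonneg (abs_nonneg (f 0)) (norm_nonneg x)
  have h5 : (0 : ℝ) ≤ Fintype.card ι := by positivity
  linarith

/-- Gaussian concentration for smooth functions with gradient of norm at most `1`. -/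
theorem measureReal_le_integral_sub_le {f : (ι → ℝ) → ℝ} (hf : Tame f)
    (hf2 : ∀ i, Tame (pd i f)) (hgrad : ∀ x, ∑ i, pd i f x ^ 2 ≤ 1) {r : ℝ} (hr : 0 ≤ r) :
    (stdPi ι).real {x | (∫ y, f y ∂(stdPi ι)) + r ≤ f x} ≤ Real.exp (-r ^ 2 / 2) := by
  set m : ℝ := ∫ y, f y ∂(stdPi ι) with hm
  obtain ⟨C, hC, hlin⟩ := exists_linear_bound hf.diff hgrad
  have hpd : ∀ t : ℝ, ∀ i, pd i (fun x => Real.exp (t * f x)) =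
      fun x => t * Real.exp (t * f x) * pd i f x := by
    intro t i
    funext x
    have h1 : HasDerivAt (fun s => Real.exp (t * s)) (t * Real.exp (t * f x)) (f x) := by
      have := ((hasDerivAt_id (f x)).const_mul t).exp
      refine this.congr_deriv ?_
      simp
      ring
    exact pd_comp (h' := fun s => t * Real.exp (t * s)) h1 (hf.diff x) i
  have hgr : ∀ t : ℝ, ExpGrowth fun x => Real.exp (t * f x) := by
    intro t
    refine expGrowth_of_bound (A := Real.exp (|t| * C)) (B := |t| * C) (by positivity)
      (by positivity) fun x => ?_
    rw [Real.abs_exp, ← Real.exp_add]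
    gcongr
    calc t * f x ≤ |t * f x| := le_abs_self _
      _ = |t| * |f x| := abs_mul _ _
      _ ≤ |t| * (C * (1 + ‖x‖)) := by gcongr; exact hlin x
      _ = _ := by ring
  have hE : ∀ t : ℝ, Tame fun x => Real.exp (t * f x) := fun t =>
    { diff := fun x => ((hf.diff x).const_mul t).exp
      growth := hgr t
      growth_pd := fun i => by
        rw [hpd]
        exact ((expGrowth_const t).mul (hgr t)).mul (hf.growth_pd i) }
  have hE2 : ∀ t : ℝ, ∀ i, Tame (pd i fun x => Real.exp (t * f x)) := by
    intro t i
    rw [hpd]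
    exact ((tame_const t).mul (hE t)).mul (hf2 i)
  have hint : ∀ t : ℝ, Integrable (fun x => Real.exp (t * f x)) (stdPi ι) := fun t =>
    (hgr t).integrable (hE t).measurable
  have hset : integrableExpSet f (stdPi ι) = Set.univ := Set.eq_univ_of_forall hint
  have hmgf : ∀ t, HasDerivAt (mgf f (stdPi ι)) (∫ x, f x * Real.exp (t * f x) ∂(stdPi ι)) t :=
    fun t => hasDerivAt_mgf (by rw [hset, interior_univ]; trivial)
  have hbound : ∀ t, 0 ≤ t → ∫ x, f x * Real.exp (t * f x) ∂(stdPi ι) ≤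
      (m + t) * mgf f (stdPi ι) t := by
    intro t ht
    have := integral_mul_le_of_gradient hf (hE t) (hE2 t) (c := t)
      (fun x y => by
        simp only [hpd]
        have h1 : ∑ i, pd i f x * pd i f y ≤ 1 := by
          have : ∑ i, pd i f x * pd i f y ≤ ∑ i, (pd i f x ^ 2 + pd i f y ^ 2) / 2 :=
            Finset.sum_le_sum fun i _ => by nlinarith [sq_nonneg (pd i f x - pd i f y)]
          rw [← Finset.sum_div, Finset.sum_add_distrib] at this
          linarith [hgrad x, hgrad y]
        have h2 : ∑ i, pd i f x * (t * Real.exp (t * f y) * pd i f y) =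
            t * Real.exp (t * f y) * ∑ i, pd i f x * pd i f y := by
          rw [Finset.mul_sum]
          exact Finset.sum_congr rfl fun i _ => by ring
        rw [h2]
        exact mul_le_of_le_one_right (by positivity) h1)
    rw [mgf]
    linarith
  have hanti : AntitoneOn (fun t => mgf f (stdPi ι) t * Real.exp (-(t * m + t ^ 2 / 2)))
      (Set.Ici 0) := by
    have hexp : ∀ t : ℝ, HasDerivAt (fun t => Real.exp (-(t * m + t ^ 2 / 2)))
        (-(m + t) * Real.exp (-(t * m + t ^ 2 / 2))) t := by
      intro t
      have := ((((hasDerivAt_id t).mul_const m).add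
        (((hasDerivAt_id t).pow 2).div_const 2)).neg).exp
      refine this.congr_deriv ?_
      simp
      ring
    have hd := fun t => (hmgf t).mul (hexp t)
    refine antitoneOn_of_deriv_nonpos (convex_Ici 0)
      (fun t _ => (hd t).continuousAt.continuousWithinAt)
      (fun t _ => (hd t).differentiableAt.differentiableWithinAt) fun t ht => ?_
    rw [interior_Ici] at ht
    refine (hd t).deriv.trans_le ?_
    have h := mul_le_mul_of_nonneg_right (hbound t (le_of_lt ht))
      (Real.exp_pos (-(t * m + t ^ 2 / 2))).le
    linarith
  have h1 := hanti (Set.mem_Ici.2 le_rfl) (Set.mem_Ici.2 hr) hr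
  simp only [mgf_zero, zero_mul, zero_add, ne_eq, OfNat.ofNat_ne_zero, not_false_eq_true, zero_pow,
    zero_div, neg_zero, Real.exp_zero, mul_one] at h1
  have h2 : mgf f (stdPi ι) r ≤ Real.exp (r * m + r ^ 2 / 2) := by
    rw [Real.exp_neg] at h1
    rwa [← div_eq_mul_inv, div_le_one (Real.exp_pos _)] at h1
  refine (measure_ge_le_exp_mul_mgf (m + r) hr (hint r)).trans ?_
  calc Real.exp (-r * (m + r)) * mgf f (stdPi ι) r
      ≤ Real.exp (-r * (m + r)) * Real.exp (r * m + r ^ 2 / 2) := by gcongr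
    _ = Real.exp (-r ^ 2 / 2) := by
        rw [← Real.exp_add]
        congr 1
        ring

end Concentration

theorem Tame.comp_real {J : Type*} [Fintype J] [DecidableEq J] {f : (J → ℝ) → ℝ} (hf : Tame f)
    {h h' : ℝ → ℝ} (hh : ∀ x, HasDerivAt h (h' (f x)) (f x)) (hg : ExpGrowth fun x => h (f x))
    (hg' : ExpGrowth fun x => h' (f x)) : Tame fun x => h (f x) where
  diff x := (hh x).differentiableAt.comp x (hf.diff x)
  growth := hg
  growth_pd i := by
    rw [funext fun x => pd_comp (hh x) (hf.diff x) i]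
    exact hg'.mul (hf.growth_pd i)

section SoftMin

variable {κ K : Type*} [Fintype κ] [DecidableEq κ] [Fintype K] [DecidableEq K]

/-- The smoothed norm `(δ² + ‖v‖²)^(1/2)`. -/
noncomputable def smoothNorm (δ : ℝ) (v : K → ℝ) : ℝ := Real.sqrt (δ ^ 2 + ∑ k, v k ^ 2)

theorem smoothNorm_pos {δ : ℝ} (hδ : 0 < δ) (v : K → ℝ) : 0 < smoothNorm δ v :=
  Real.sqrt_pos.2 (by positivity)

theorem sq_smoothNorm (δ : ℝ) (v : K → ℝ) : smoothNorm δ v ^ 2 = δ ^ 2 + ∑ k, v k ^ 2 :=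
  Real.sq_sqrt (by positivity)

theorem le_smoothNorm (δ : ℝ) (v : K → ℝ) : δ ≤ smoothNorm δ v :=
  Real.le_sqrt_of_sq_le (by
    have : 0 ≤ ∑ k, v k ^ 2 := by positivity
    linarith)

theorem smoothNorm_le {δ : ℝ} (hδ : 0 < δ) (v : K → ℝ) :
    smoothNorm δ v ≤ δ + Real.sqrt (∑ k, v k ^ 2) := by
  have h : 0 ≤ ∑ k, v k ^ 2 := by positivity
  refine Real.sqrt_le_iff.2 ⟨by positivity, ?_⟩
  nlinarith [Real.sq_sqrt h, mul_nonneg hδ.le (Real.sqrt_nonneg (∑ k, v k ^ 2))]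

theorem hasDerivAt_sqrt_add {δ : ℝ} (hδ : 0 < δ) (v : K → ℝ) :
    HasDerivAt Real.sqrt (1 / (2 * smoothNorm δ v)) (δ ^ 2 + ∑ k, v k ^ 2) :=
  Real.hasDerivAt_sqrt (by positivity)

theorem tame_smoothNorm {δ : ℝ} (hδ : 0 < δ) : Tame (smoothNorm δ : (K → ℝ) → ℝ) := by
  have hq : Tame fun v : K → ℝ => δ ^ 2 + ∑ k, v k ^ 2 := by
    simp only [pow_two]
    exact (tame_const _).add (Tame.sum _ fun k _ => (tame_coord k).mul (tame_coord k))
  refine hq.comp_real (h := Real.sqrt) (h' := fun s => 1 / (2 * Real.sqrt s))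
    (fun v => hasDerivAt_sqrt_add hδ v) (((expGrowth_const 1).add hq.growth).of_le fun v => ?_)
    (expGrowth_of_abs_le (1 / (2 * δ)) fun v => ?_)
  · rw [abs_of_nonneg (Real.sqrt_nonneg _)]
    refine Real.sqrt_le_iff.2 ⟨by positivity, ?_⟩
    have : 0 ≤ δ ^ 2 + ∑ k, v k ^ 2 := by positivity
    nlinarith
  · have := le_smoothNorm δ v
    rw [smoothNorm] at this
    rw [abs_of_nonneg (by positivity)]
    gcongr

theorem pd_smoothNorm {δ : ℝ} (hδ : 0 < δ) (k : K) (v : K → ℝ) :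
    pd k (smoothNorm δ) v = v k * (smoothNorm δ v)⁻¹ := by
  have hsq : ∀ l, HasFDerivAt (fun v : K → ℝ => v l ^ 2)
      ((2 * v l) • (ContinuousLinearMap.proj l : (K → ℝ) →L[ℝ] ℝ)) v := fun l => by
    have h : HasFDerivAt (fun y : K → ℝ => y l) (ContinuousLinearMap.proj l : (K → ℝ) →L[ℝ] ℝ) v :=
      (ContinuousLinearMap.proj l : (K → ℝ) →L[ℝ] ℝ).hasFDerivAt
    simpa using h.pow 2
  have hq : HasFDerivAt (fun v : K → ℝ => δ ^ 2 + ∑ k, v k ^ 2) _ v :=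
    (HasFDerivAt.fun_sum fun l (_ : l ∈ Finset.univ) => hsq l).const_add (δ ^ 2)
  have h : HasFDerivAt (smoothNorm δ) _ v := (hasDerivAt_sqrt_add hδ v).comp_hasFDerivAt v hq
  rw [pd, h.fderiv]
  have := (smoothNorm_pos hδ v).ne'
  simp [Pi.single_apply]
  field_simp

theorem tame_inv_smoothNorm {δ : ℝ} (hδ : 0 < δ) :
    Tame fun v : K → ℝ => (smoothNorm δ v)⁻¹ := by
  refine (tame_smoothNorm hδ).comp_real (h := fun s => s⁻¹) (h' := fun s => -(s ^ 2)⁻¹)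
    (fun v => hasDerivAt_inv (smoothNorm_pos hδ v).ne') (expGrowth_of_abs_le δ⁻¹ fun v => ?_)
    (expGrowth_of_abs_le (δ ^ 2)⁻¹ fun v => ?_)
  · have := le_smoothNorm δ v
    rw [abs_of_nonneg (inv_nonneg.2 (hδ.le.trans this))]
    gcongr
  · have := le_smoothNorm δ v
    rw [abs_neg, abs_of_nonneg (by positivity)]
    gcongr

/-- The matrix which selects the block `z` of a vector indexed by `κ × Option K`, without its
scalar coordinate. -/
def blockProj (z : κ) : Matrix K (κ × Option K) ℝ :=
  Matrix.of fun k i => if i = (z, some k) then 1 else 0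

theorem blockProj_apply (z : κ) (k : K) (i : κ × Option K) :
    (blockProj z : Matrix K (κ × Option K) ℝ) k i = if i = (z, some k) then 1 else 0 := rfl

theorem blockProj_mulVec (z : κ) (V : κ × Option K → ℝ) :
    (blockProj z : Matrix K (κ × Option K) ℝ) *ᵥ V = fun k => V (z, some k) := by
  funext k
  simp [blockProj, Matrix.mulVec, dotProduct]

/-- The smoothed norm of the block `z` plus its scalar coordinate. -/
noncomputable def blockVal (δ : ℝ) (z : κ) (V : κ × Option K → ℝ) : ℝ :=
  smoothNorm δ (fun k => V (z, some k)) + V (z, none)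

/-- The partial derivatives of `blockVal δ z` in the coordinates of the block `z`. -/
noncomputable def blockGrad (δ : ℝ) (z : κ) (o : Option K) (V : κ × Option K → ℝ) : ℝ :=
  match o with
  | none => 1
  | some k => V (z, some k) * (smoothNorm δ fun k => V (z, some k))⁻¹

theorem tame_block {f : (K → ℝ) → ℝ} (hf : Tame f) (z : κ) :
    Tame fun V : κ × Option K → ℝ => f fun k => V (z, some k) := by
  simpa only [blockProj_mulVec] using hf.comp_mulVec (blockProj z : Matrix K (κ × Option K) ℝ)

theorem tame_blockVal {δ : ℝ} (hδ : 0 < δ) (z : κ) :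
    Tame (blockVal δ z : (κ × Option K → ℝ) → ℝ) :=
  (tame_block (tame_smoothNorm hδ) z).add (tame_coord (z, none))

theorem tame_blockGrad {δ : ℝ} (hδ : 0 < δ) (z : κ) (o : Option K) :
    Tame (blockGrad δ z o : (κ × Option K → ℝ) → ℝ) := by
  cases o with
  | none => exact tame_const 1
  | some k => exact (tame_coord (z, some k)).mul (tame_block (tame_inv_smoothNorm hδ) z)

theorem pd_block {f : (K → ℝ) → ℝ} (hf : Differentiable ℝ f) (z z' : κ) (o : Option K)
    (V : κ × Option K → ℝ) : pd (z', o) (fun V => f fun k => V (z, some k)) V =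
      ∑ k, (if (z', o) = (z, some k) then 1 else 0) * pd k f (fun k => V (z, some k)) := by
  have := pd_comp_mulVec hf (blockProj z : Matrix K (κ × Option K) ℝ) (z', o) V
  simpa only [blockProj_mulVec, blockProj_apply] using this

theorem pd_block_of_ne {f : (K → ℝ) → ℝ} (hf : Differentiable ℝ f) {z z' : κ} (h : z' ≠ z)
    (o : Option K) (V : κ × Option K → ℝ) :
    pd (z', o) (fun V => f fun k => V (z, some k)) V = 0 := by
  rw [pd_block hf]
  simp [h]

theorem pd_blockVal {δ : ℝ} (hδ : 0 < δ) (z z' : κ) (o : Option K) (V : κ × Option K → ℝ) :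
    pd (z', o) (blockVal δ z) V = if z' = z then blockGrad δ z o V else 0 := by
  have h := pd_add (tame_block (tame_smoothNorm hδ) z).diff
    (tame_coord (J := κ × Option K) (z, none)).diff (z', o) V
  rw [pd_block (tame_smoothNorm hδ).diff, pd_coord] at h
  refine h.trans ?_
  by_cases hz : z' = z
  · subst hz
    cases o with
    | none => simp [blockGrad]
    | some k => simp [blockGrad, pd_smoothNorm hδ]
  · simp [hz, Ne.symm hz]

theorem pd_blockGrad_of_ne {δ : ℝ} (hδ : 0 < δ) {z z' : κ} (h : z' ≠ z) (o o' : Option K)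
    (V : κ × Option K → ℝ) : pd (z', o') (blockGrad δ z o) V = 0 := by
  cases o with
  | none => exact pd_const _ _ _
  | some k =>
    have h1 := pd_mul (tame_coord (J := κ × Option K) (z, some k)).diff
      (tame_block (tame_inv_smoothNorm hδ) z).diff (z', o') V
    refine h1.trans ?_
    rw [pd_coord, pd_block_of_ne (tame_inv_smoothNorm hδ).diff h]
    simp [Ne.symm h]

theorem sum_blockGrad_sq_le {δ : ℝ} (hδ : 0 < δ) (z : κ) (V : κ × Option K → ℝ) :
    ∑ k, blockGrad δ z (some k) V ^ 2 ≤ 1 := by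
  simp only [blockGrad, mul_pow, ← Finset.sum_mul, inv_pow, sq_smoothNorm]
  rw [← div_eq_mul_inv, div_le_one (by positivity)]
  nlinarith

/-- The exponential weight of the block `z`. -/
noncomputable def expWeight (β δ : ℝ) (z : κ) (V : κ × Option K → ℝ) : ℝ :=
  Real.exp (-β * blockVal δ z V)

/-- The partition function. -/
noncomputable def partitionFn (β δ : ℝ) (V : κ × Option K → ℝ) : ℝ := ∑ z, expWeight β δ z V

/-- The soft minimum of the block values. -/
noncomputable def softMin (β δ : ℝ) (V : κ × Option K → ℝ) : ℝ :=
  -β⁻¹ * Real.log (partitionFn β δ V)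

/-- The Gibbs weight of the block `z`. -/
noncomputable def gibbs (β δ : ℝ) (z : κ) (V : κ × Option K → ℝ) : ℝ :=
  expWeight β δ z V * (partitionFn β δ V)⁻¹

theorem expWeight_pos (β δ : ℝ) (z : κ) (V : κ × Option K → ℝ) : 0 < expWeight β δ z V :=
  Real.exp_pos _

theorem partitionFn_pos [Nonempty κ] (β δ : ℝ) (V : κ × Option K → ℝ) : 0 < partitionFn β δ V :=
  Finset.sum_pos (fun z _ => expWeight_pos β δ z V) Finset.univ_nonempty

theorem gibbs_nonneg (β δ : ℝ) (z : κ) (V : κ × Option K → ℝ) : 0 ≤ gibbs β δ z V :=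
  mul_nonneg (expWeight_pos _ _ _ _).le
    (inv_nonneg.2 (Finset.sum_nonneg fun z _ => (expWeight_pos β δ z V).le))

theorem sum_gibbs [Nonempty κ] (β δ : ℝ) (V : κ × Option K → ℝ) : ∑ z, gibbs β δ z V = 1 := by
  simp only [gibbs, ← Finset.sum_mul]
  exact mul_inv_cancel₀ (partitionFn_pos β δ V).ne'

theorem abs_blockVal_le {δ : ℝ} (hδ : 0 < δ) (z : κ) (V : κ × Option K → ℝ) :
    |blockVal δ z V| ≤ (δ + Fintype.card K + 1) * (1 + ‖V‖) := by
  have h1 : ∀ i, |V i| ≤ ‖V‖ := fun i => norm_le_pi_norm V i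
  have h2 : Real.sqrt (∑ k, V (z, some k) ^ 2) ≤ Fintype.card K * ‖V‖ := by
    refine Real.sqrt_le_iff.2 ⟨by positivity, ?_⟩
    calc ∑ k, V (z, some k) ^ 2 ≤ ∑ _k : K, ‖V‖ ^ 2 :=
          Finset.sum_le_sum fun k _ => sq_le_sq' (neg_le_of_abs_le (h1 _)) (le_of_abs_le (h1 _))
      _ = Fintype.card K * ‖V‖ ^ 2 := by simp
      _ ≤ (Fintype.card K : ℝ) ^ 2 * ‖V‖ ^ 2 := by
          gcongr
          exact_mod_cast Nat.le_self_pow two_ne_zero _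
      _ = _ := by ring
  have h3 := smoothNorm_le hδ fun k => V (z, some k)
  have h4 := smoothNorm_pos hδ fun k => V (z, some k)
  rw [blockVal]
  refine (abs_add_le _ _).trans ?_
  rw [abs_of_pos h4]
  have h5 := h1 (z, none)
  have h6 : 0 ≤ δ * ‖V‖ := by positivity
  have h7 : (0 : ℝ) ≤ Fintype.card K := by positivity
  linarith

theorem expGrowth_exp_blockVal {δ : ℝ} (hδ : 0 < δ) (c : ℝ) (z : κ) :
    ExpGrowth fun V : κ × Option K → ℝ => Real.exp (c * blockVal δ z V) := by
  set C : ℝ := δ + Fintype.card K + 1 with hC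
  refine expGrowth_of_bound (A := Real.exp (|c| * C)) (B := |c| * C) (by positivity)
    (by positivity) fun V => ?_
  rw [Real.abs_exp, ← Real.exp_add]
  gcongr
  calc c * blockVal δ z V ≤ |c * blockVal δ z V| := le_abs_self _
    _ = |c| * |blockVal δ z V| := abs_mul _ _
    _ ≤ |c| * (C * (1 + ‖V‖)) := by gcongr; exact abs_blockVal_le hδ z V
    _ = _ := by ring

theorem hasDerivAt_exp_mul (c s : ℝ) :
    HasDerivAt (fun s => Real.exp (c * s)) (c * Real.exp (c * s)) s := by
  have := ((hasDerivAt_id s).const_mul c).exp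
  refine this.congr_deriv ?_
  simp
  ring

theorem tame_expWeight (β : ℝ) {δ : ℝ} (hδ : 0 < δ) (z : κ) :
    Tame (expWeight β δ z : (κ × Option K → ℝ) → ℝ) :=
  (tame_blockVal hδ z).comp_real (h := fun s => Real.exp (-β * s))
    (h' := fun s => -β * Real.exp (-β * s)) (fun _ => hasDerivAt_exp_mul _ _)
    (expGrowth_exp_blockVal hδ _ z) ((expGrowth_const _).mul (expGrowth_exp_blockVal hδ _ z))

theorem pd_expWeight (β : ℝ) {δ : ℝ} (hδ : 0 < δ) (z z' : κ) (o : Option K)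
    (V : κ × Option K → ℝ) : pd (z', o) (expWeight β δ z) V =
      if z' = z then -β * expWeight β δ z V * blockGrad δ z o V else 0 := by
  have := pd_comp (h := fun s => Real.exp (-β * s)) (h' := fun s => -β * Real.exp (-β * s))
    (hasDerivAt_exp_mul _ _) ((tame_blockVal hδ z).diff V) (z', o)
  refine this.trans ?_
  rw [pd_blockVal hδ]
  split_ifs <;> simp [expWeight]

theorem tame_partitionFn (β : ℝ) {δ : ℝ} (hδ : 0 < δ) :
    Tame (partitionFn β δ : (κ × Option K → ℝ) → ℝ) :=
  Tame.sum _ fun z _ => tame_expWeight β hδ z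

theorem pd_sum {J ι : Type*} [Fintype J] [DecidableEq J] (s : Finset ι) {f : ι → (J → ℝ) → ℝ}
    (hf : ∀ i ∈ s, Differentiable ℝ (f i)) (j : J) (x : J → ℝ) :
    pd j (fun y => ∑ i ∈ s, f i y) x = ∑ i ∈ s, pd j (f i) x := by
  simp only [pd]
  rw [(HasFDerivAt.fun_sum fun i hi => (hf i hi x).hasFDerivAt).fderiv]
  simp

theorem pd_partitionFn (β : ℝ) {δ : ℝ} (hδ : 0 < δ) (z : κ) (o : Option K)
    (V : κ × Option K → ℝ) : pd (z, o) (partitionFn β δ) V =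
      -β * expWeight β δ z V * blockGrad δ z o V := by
  have := pd_sum Finset.univ (fun z' (_ : z' ∈ Finset.univ) => (tame_expWeight β hδ z').diff)
    (z, o) V
  refine this.trans ?_
  simp [pd_expWeight β hδ]

variable [Nonempty κ]

theorem expGrowth_inv_partitionFn (β : ℝ) {δ : ℝ} (hδ : 0 < δ) :
    ExpGrowth fun V : κ × Option K → ℝ => (partitionFn β δ V)⁻¹ := by
  obtain ⟨z⟩ := ‹Nonempty κ›
  refine (expGrowth_exp_blockVal hδ β z).of_le fun V => ?_
  have h : expWeight β δ z V ≤ partitionFn β δ V :=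
    Finset.single_le_sum (f := fun z => expWeight β δ z V) (fun z _ => (expWeight_pos β δ z V).le)
      (Finset.mem_univ z)
  rw [abs_of_nonneg (inv_nonneg.2 ((expWeight_pos β δ z V).le.trans h))]
  refine (inv_anti₀ (expWeight_pos β δ z V) h).trans_eq ?_
  rw [expWeight, ← Real.exp_neg]
  congr 1
  ring

theorem tame_inv_partitionFn (β : ℝ) {δ : ℝ} (hδ : 0 < δ) :
    Tame fun V : κ × Option K → ℝ => (partitionFn β δ V)⁻¹ := by
  have h := expGrowth_inv_partitionFn (κ := κ) (K := K) β hδ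
  refine (tame_partitionFn β hδ).comp_real (h := fun s => s⁻¹) (h' := fun s => -(s ^ 2)⁻¹)
    (fun V => hasDerivAt_inv (partitionFn_pos β δ V).ne') h ?_
  simpa only [pow_two, mul_inv] using (h.mul h).neg

theorem tame_softMin (β : ℝ) {δ : ℝ} (hδ : 0 < δ) :
    Tame (softMin β δ : (κ × Option K → ℝ) → ℝ) := by
  have h := expGrowth_inv_partitionFn (κ := κ) (K := K) β hδ
  refine (tame_const (-β⁻¹)).mul ((tame_partitionFn β hδ).comp_real (h := Real.log)
    (h' := fun s => s⁻¹) (fun V => Real.hasDerivAt_log (partitionFn_pos β δ V).ne')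
    (((tame_partitionFn β hδ).growth.add h).of_le fun V => ?_) h)
  have hp := partitionFn_pos β δ V
  have h1 := Real.log_le_sub_one_of_pos hp
  have h2 := Real.log_le_sub_one_of_pos (inv_pos.2 hp)
  rw [Real.log_inv] at h2
  have h3 := inv_pos.2 hp
  rw [abs_le]
  constructor <;> linarith

theorem tame_gibbs (β : ℝ) {δ : ℝ} (hδ : 0 < δ) (z : κ) :
    Tame (gibbs β δ z : (κ × Option K → ℝ) → ℝ) :=
  (tame_expWeight β hδ z).mul (tame_inv_partitionFn β hδ)

theorem pd_softMin {β δ : ℝ} (hβ : 0 < β) (hδ : 0 < δ) (z : κ) (o : Option K) :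
    pd (z, o) (softMin β δ) = fun V => gibbs β δ z V * blockGrad δ z o V := by
  funext V
  have hp := partitionFn_pos β δ V
  have := pd_comp (h := fun s => -β⁻¹ * Real.log s) (h' := fun s => -β⁻¹ * s⁻¹)
    ((Real.hasDerivAt_log hp.ne').const_mul (-β⁻¹)) ((tame_partitionFn β hδ).diff V) (z, o)
  refine this.trans ?_
  rw [pd_partitionFn β hδ, gibbs]
  field_simp

theorem tame_pd_softMin {β δ : ℝ} (hβ : 0 < β) (hδ : 0 < δ) (i : κ × Option K) :
    Tame (pd i (softMin β δ : (κ × Option K → ℝ) → ℝ)) := by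
  obtain ⟨z, o⟩ := i
  rw [pd_softMin hβ hδ]
  exact (tame_gibbs β hδ z).mul (tame_blockGrad hδ z o)

theorem pd_pd_softMin {β δ : ℝ} (hβ : 0 < β) (hδ : 0 < δ) {z z' : κ} (hz : z' ≠ z)
    (o o' : Option K) (V : κ × Option K → ℝ) : pd (z', o') (pd (z, o) (softMin β δ)) V =
      β * (gibbs β δ z V * gibbs β δ z' V) * (blockGrad δ z o V * blockGrad δ z' o' V) := by
  have hp := partitionFn_pos β δ V
  have h1 : pd (z', o') (fun V => (partitionFn β δ V)⁻¹) V =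
      β * gibbs β δ z' V * blockGrad δ z' o' V * (partitionFn β δ V)⁻¹ := by
    have := pd_comp (h := fun s => s⁻¹) (h' := fun s => -(s ^ 2)⁻¹)
      (hasDerivAt_inv hp.ne') ((tame_partitionFn β hδ).diff V) (z', o')
    refine this.trans ?_
    rw [pd_partitionFn β hδ, gibbs]
    field_simp
  have h2 : pd (z', o') (gibbs β δ z) V =
      β * (gibbs β δ z V * gibbs β δ z' V) * blockGrad δ z' o' V := by
    refine (pd_mul (tame_expWeight β hδ z).diff (tame_inv_partitionFn β hδ).diff (z', o')
      V).trans ?_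
    rw [h1, pd_expWeight β hδ, if_neg hz, gibbs, gibbs]
    ring
  rw [pd_softMin hβ hδ]
  refine (pd_mul (tame_gibbs β hδ z).diff (tame_blockGrad hδ z o).diff (z', o') V).trans ?_
  rw [h2, pd_blockGrad_of_ne hδ hz]
  ring

theorem softMin_le {β : ℝ} (hβ : 0 < β) (δ : ℝ) (z : κ) (V : κ × Option K → ℝ) :
    softMin β δ V ≤ blockVal δ z V := by
  have h : expWeight β δ z V ≤ partitionFn β δ V :=
    Finset.single_le_sum (f := fun z => expWeight β δ z V) (fun z _ => (expWeight_pos β δ z V).le)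
      (Finset.mem_univ z)
  have h2 := Real.log_le_log (expWeight_pos β δ z V) h
  rw [expWeight, Real.log_exp] at h2
  have h3 := mul_le_mul_of_nonneg_left h2 (inv_pos.2 hβ).le
  have h4 : β⁻¹ * (-β * blockVal δ z V) = - blockVal δ z V := by field_simp
  rw [softMin]
  linarith

theorem le_softMin {β : ℝ} (hβ : 0 < β) (δ c : ℝ) {V : κ × Option K → ℝ}
    (h : ∀ z, c ≤ blockVal δ z V) : c - Real.log (Fintype.card κ) / β ≤ softMin β δ V := by
  have h1 : partitionFn β δ V ≤ Fintype.card κ * Real.exp (-β * c) := by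
    calc partitionFn β δ V ≤ ∑ _z : κ, Real.exp (-β * c) := Finset.sum_le_sum fun z _ => by
          refine Real.exp_le_exp.2 ?_
          have := mul_le_mul_of_nonneg_left (h z) hβ.le
          linarith
      _ = _ := by simp
  have hc : (0 : ℝ) < Fintype.card κ := by exact_mod_cast Fintype.card_pos
  have h2 := Real.log_le_log (partitionFn_pos β δ V) h1
  rw [Real.log_mul hc.ne' (Real.exp_pos _).ne', Real.log_exp] at h2
  have h3 := mul_le_mul_of_nonneg_left h2 (inv_pos.2 hβ).le
  have h4 : β⁻¹ * (Real.log (Fintype.card κ) + -β * c) =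
      Real.log (Fintype.card κ) / β - c := by field_simp; ring
  rw [softMin]
  linarith

theorem softMin_add {β : ℝ} (hβ : 0 < β) (δ c : ℝ) {V V' : κ × Option K → ℝ}
    (h : ∀ z, blockVal δ z V' = blockVal δ z V + c) : softMin β δ V' = softMin β δ V + c := by
  have h1 : partitionFn β δ V' = partitionFn β δ V * Real.exp (-β * c) := by
    rw [partitionFn, partitionFn, Finset.sum_mul]
    refine Finset.sum_congr rfl fun z _ => ?_
    rw [expWeight, expWeight, h, ← Real.exp_add]
    congr 1
    ring
  rw [softMin, softMin, h1, Real.log_mul (partitionFn_pos β δ V).ne' (Real.exp_pos _).ne',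
    Real.log_exp]
  field_simp
  ring

end SoftMin

section Gordon

variable {κ K D : Type*} [Fintype κ] [DecidableEq κ] [Fintype K] [DecidableEq K] [Fintype D]
  [DecidableEq D]

/-- The coefficients of the process `(M z, g₀)` in the variables `M` and `g₀`. -/
def matrixProcess (Z : κ → D → ℝ) : Matrix (κ × Option K) (Option (K × D) ⊕ (K ⊕ D)) ℝ :=
  Matrix.of fun i j =>
    match i, j with
    | (z, some k), Sum.inl (some (k', l)) => if k = k' then Z z l else 0
    | (_, none), Sum.inl none => 1
    | _, _ => 0

/-- The coefficients of the process `(g, ⟨h, z⟩)` in the variables `g` and `h`. -/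
def vectorProcess (Z : κ → D → ℝ) : Matrix (κ × Option K) (Option (K × D) ⊕ (K ⊕ D)) ℝ :=
  Matrix.of fun i j =>
    match i, j with
    | (_, some k), Sum.inr (Sum.inl k') => if k = k' then 1 else 0
    | (z, none), Sum.inr (Sum.inr l) => Z z l
    | _, _ => 0

/-- The coefficients of the process `(M z, 0)` in the variables `M`. -/
def blockMatrix (Z : κ → D → ℝ) : Matrix (κ × Option K) (K × D) ℝ :=
  Matrix.of fun i j =>
    match i with
    | (z, some k) => if k = j.1 then Z z j.2 else 0
    | (_, none) => 0

theorem matrixProcess_mulVec_some (Z : κ → D → ℝ) (x : Option (K × D) ⊕ (K ⊕ D) → ℝ) (z : κ)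
    (k : K) : (matrixProcess Z *ᵥ x) (z, some k) = ∑ l, x (Sum.inl (some (k, l))) * Z z l := by
  simp [Matrix.mulVec, dotProduct, matrixProcess, Fintype.sum_sum_type, Fintype.sum_option,
    Fintype.sum_prod_type, mul_comm]

theorem matrixProcess_mulVec_none (Z : κ → D → ℝ) (x : Option (K × D) ⊕ (K ⊕ D) → ℝ) (z : κ) :
    (matrixProcess Z *ᵥ x) (z, (none : Option K)) = x (Sum.inl none) := by
  simp [Matrix.mulVec, dotProduct, matrixProcess, Fintype.sum_sum_type, Fintype.sum_option]

theorem vectorProcess_mulVec_some (Z : κ → D → ℝ) (x : Option (K × D) ⊕ (K ⊕ D) → ℝ) (z : κ)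
    (k : K) : (vectorProcess Z *ᵥ x) (z, some k) = x (Sum.inr (Sum.inl k)) := by
  simp [Matrix.mulVec, dotProduct, vectorProcess, Fintype.sum_sum_type]

theorem vectorProcess_mulVec_none (Z : κ → D → ℝ) (x : Option (K × D) ⊕ (K ⊕ D) → ℝ) (z : κ) :
    (vectorProcess Z *ᵥ x) (z, (none : Option K)) = ∑ l, x (Sum.inr (Sum.inr l)) * Z z l := by
  simp [Matrix.mulVec, dotProduct, vectorProcess, Fintype.sum_sum_type, mul_comm]

theorem blockMatrix_mulVec_some (Z : κ → D → ℝ) (x : K × D → ℝ) (z : κ)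
    (k : K) : (blockMatrix Z *ᵥ x) (z, some k) = ∑ l, x (k, l) * Z z l := by
  simp [Matrix.mulVec, dotProduct, blockMatrix, Fintype.sum_prod_type, mul_comm]

theorem blockMatrix_mulVec_none (Z : κ → D → ℝ) (x : K × D → ℝ) (z : κ) :
    (blockMatrix Z *ᵥ x) (z, (none : Option K)) = 0 := by
  simp [Matrix.mulVec, dotProduct, blockMatrix]

theorem matrixProcess_mul_vectorProcess (Z : κ → D → ℝ) (i i' : κ × Option K)
    (j : Option (K × D) ⊕ (K ⊕ D)) : matrixProcess Z i j * vectorProcess Z i' j = 0 := by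
  obtain ⟨z, _ | k⟩ := i <;> obtain ⟨z', _ | k'⟩ := i' <;>
    obtain (_ | ⟨_, _⟩) | (_ | _) := j <;> simp [matrixProcess, vectorProcess]

/-- The difference of the covariances of the two processes. -/
theorem covariance_diff (Z : κ → D → ℝ) (z z' : κ) (o o' : Option K) :
    ∑ j, (vectorProcess Z (z, o) j * vectorProcess Z (z', o') j -
      matrixProcess Z (z, o) j * matrixProcess Z (z', o') j) =
      if o = o' then (if o = none then -1 else 1) * (1 - ∑ l, Z z l * Z z' l) else 0 := by
  rw [Finset.sum_sub_distrib]
  cases o <;> cases o' <;>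
    simp [vectorProcess, matrixProcess, Fintype.sum_sum_type, Fintype.sum_option,
      Fintype.sum_prod_type]
  rename_i k k'
  by_cases h : k = k'
  · subst h
    simp
  · simp [h]

variable [Nonempty κ]

theorem gordon_condition {β δ : ℝ} (hβ : 0 < β) (hδ : 0 < δ) {Z : κ → D → ℝ}
    (hZ : ∀ z, ∑ l, Z z l ^ 2 = 1) (V : κ × Option K → ℝ) :
    ∑ i, ∑ i', (∑ j, (vectorProcess Z i j * vectorProcess Z i' j -
      matrixProcess Z i j * matrixProcess Z i' j)) * pd i' (pd i (softMin β δ)) V ≤ 0 := by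
  simp only [Fintype.sum_prod_type]
  have hterm : ∀ z z', ∑ o : Option K, ∑ o' : Option K,
      (∑ j, (vectorProcess Z (z, o) j * vectorProcess Z (z', o') j -
        matrixProcess Z (z, o) j * matrixProcess Z (z', o') j)) *
        pd (z', o') (pd (z, o) (softMin β δ)) V ≤ 0 := by
    intro z z'
    simp only [covariance_diff]
    by_cases h : z' = z
    · subst h
      have : ∑ l, Z z' l * Z z' l = 1 := by simpa only [pow_two] using hZ z'
      simp [this]
    · simp only [pd_pd_softMin hβ hδ h]
      have hle : ∑ l, Z z l * Z z' l ≤ 1 := by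
        have : ∑ l, Z z l * Z z' l ≤ ∑ l, (Z z l ^ 2 + Z z' l ^ 2) / 2 :=
          Finset.sum_le_sum fun l _ => by nlinarith [sq_nonneg (Z z l - Z z' l)]
        rw [← Finset.sum_div, Finset.sum_add_distrib, hZ, hZ] at this
        linarith
      have hn : ∑ k, blockGrad δ z (some k) V * blockGrad δ z' (some k) V ≤ 1 := by
        have h1 := sum_blockGrad_sq_le hδ z V
        have h2 := sum_blockGrad_sq_le hδ z' V
        have : ∑ k, blockGrad δ z (some k) V * blockGrad δ z' (some k) V ≤
            ∑ k, (blockGrad δ z (some k) V ^ 2 + blockGrad δ z' (some k) V ^ 2) / 2 :=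
          Finset.sum_le_sum fun k _ => by
            nlinarith [sq_nonneg (blockGrad δ z (some k) V - blockGrad δ z' (some k) V)]
        rw [← Finset.sum_div, Finset.sum_add_distrib] at this
        linarith
      set c := β * (gibbs β δ z V * gibbs β δ z' V) with hc
      have hc0 : 0 ≤ c := mul_nonneg hβ.le (mul_nonneg (gibbs_nonneg _ _ _ _)
        (gibbs_nonneg _ _ _ _))
      set s := 1 - ∑ l, Z z l * Z z' l with hs
      have key : (∑ o : Option K, ∑ o' : Option K,
          (if o = o' then (if o = none then -1 else 1) * s else 0) *
            (c * (blockGrad δ z o V * blockGrad δ z' o' V))) =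
          -(c * s * (1 - ∑ k, blockGrad δ z (some k) V * blockGrad δ z' (some k) V)) := by
        simp only [ite_mul, zero_mul, Finset.sum_ite_eq, Finset.mem_univ, if_true]
        rw [Fintype.sum_option]
        simp only [if_true, reduceCtorEq, if_false, mul_sub, Finset.mul_sum]
        simp only [blockGrad]
        rw [neg_sub, sub_eq_add_neg, add_comm]
        congr 1
        · exact Finset.sum_congr rfl fun k _ => by ring
        · ring
      rw [key]
      have : 0 ≤ c * s * (1 - ∑ k, blockGrad δ z (some k) V * blockGrad δ z' (some k) V) :=
        mul_nonneg (mul_nonneg hc0 (by linarith)) (by linarith)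
      linarith
  refine Finset.sum_nonpos fun z _ => ?_
  rw [Finset.sum_comm]
  exact Finset.sum_nonpos fun z' _ => hterm z z'

/-- The soft minimum of the smoothed norms of `M z`, as a function of the entries of `M`. -/
noncomputable def softMinNorm (β δ : ℝ) (Z : κ → D → ℝ) (M : K × D → ℝ) : ℝ :=
  softMin β δ (blockMatrix Z *ᵥ M)

theorem tame_softMinNorm (β : ℝ) {δ : ℝ} (hδ : 0 < δ) (Z : κ → D → ℝ) :
    Tame (softMinNorm β δ Z : (K × D → ℝ) → ℝ) :=
  (tame_softMin β hδ).comp_mulVec _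

theorem pd_softMinNorm {β δ : ℝ} (hβ : 0 < β) (hδ : 0 < δ) (Z : κ → D → ℝ) (j : K × D) :
    pd j (softMinNorm β δ Z) = fun M => ∑ z, gibbs β δ z (blockMatrix Z *ᵥ M) *
      (blockGrad δ z (some j.1) (blockMatrix Z *ᵥ M) * Z z j.2) := by
  funext M
  refine (pd_comp_mulVec (tame_softMin β hδ).diff _ j M).trans ?_
  simp only [Fintype.sum_prod_type, pd_softMin hβ hδ]
  refine Finset.sum_congr rfl fun z _ => ?_
  rw [Fintype.sum_option]
  simp only [blockMatrix, Matrix.of_apply, zero_mul, ite_mul, Finset.sum_ite_eq', Finset.mem_univ,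
    if_true, zero_add]
  ring

theorem tame_pd_softMinNorm {β δ : ℝ} (hβ : 0 < β) (hδ : 0 < δ) (Z : κ → D → ℝ) (j : K × D) :
    Tame (pd j (softMinNorm β δ Z : (K × D → ℝ) → ℝ)) := by
  rw [pd_softMinNorm hβ hδ]
  exact Tame.sum _ fun z _ => ((tame_gibbs β hδ z).comp_mulVec _).mul
    (((tame_blockGrad hδ z _).comp_mulVec _).mul (tame_const _))

theorem sum_sq_pd_softMinNorm_le {β δ : ℝ} (hβ : 0 < β) (hδ : 0 < δ) {Z : κ → D → ℝ}
    (hZ : ∀ z, ∑ l, Z z l ^ 2 = 1) (M : K × D → ℝ) :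
    ∑ j, pd j (softMinNorm β δ Z) M ^ 2 ≤ 1 := by
  simp only [pd_softMinNorm hβ hδ]
  set V := (blockMatrix Z *ᵥ M : κ × Option K → ℝ)
  have h1 : ∀ j : K × D, (∑ z, gibbs β δ z V * (blockGrad δ z (some j.1) V * Z z j.2)) ^ 2 ≤
      ∑ z, gibbs β δ z V * (blockGrad δ z (some j.1) V * Z z j.2) ^ 2 := fun j =>
    Real.pow_arith_mean_le_arith_mean_pow_of_even _ _ _ (fun z _ => gibbs_nonneg _ _ _ _)
      (sum_gibbs β δ V) even_two
  refine (Finset.sum_le_sum fun j _ => h1 j).trans ?_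
  rw [Finset.sum_comm, ← sum_gibbs β δ V]
  refine Finset.sum_le_sum fun z _ => ?_
  rw [← Finset.mul_sum]
  refine mul_le_of_le_one_right (gibbs_nonneg _ _ _ _) ?_
  rw [Fintype.sum_prod_type]
  simp only [mul_pow, ← Finset.mul_sum, hZ, mul_one]
  exact sum_blockGrad_sq_le hδ z V

theorem integral_softMinNorm_ge {β δ : ℝ} (hβ : 0 < β) (hδ : 0 < δ) {Z : κ → D → ℝ}
    (hZ : ∀ z, ∑ l, Z z l ^ 2 = 1) {W : (D → ℝ) → ℝ} (hWm : Measurable W)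
    (hWi : Integrable W (stdPi D)) (hW : ∀ z h, -∑ l, h l * Z z l ≤ W h) :
    (∫ v, smoothNorm δ v ∂(stdPi K)) - (∫ h, W h ∂(stdPi D)) - Real.log (Fintype.card κ) / β ≤
      ∫ M, softMinNorm β δ Z M ∂(stdPi (K × D)) := by
  have hcomp := integral_gaussian_comparison (J := Option (K × D) ⊕ (K ⊕ D)) (tame_softMin β hδ)
    (tame_pd_softMin hβ hδ) (A := matrixProcess Z) (B := vectorProcess Z)
    (matrixProcess_mul_vectorProcess Z) (gordon_condition (K := K) hβ hδ hZ)
  set J := Option (K × D) ⊕ (K ⊕ D)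
  have inj1 : Function.Injective fun p : K × D => (Sum.inl (some p) : J) := fun p q h => by
    simpa using h
  have inj2 : Function.Injective fun k : K => (Sum.inr (Sum.inl k) : J) := fun p q h => by
    simpa using h
  have inj3 : Function.Injective fun l : D => (Sum.inr (Sum.inr l) : J) := fun p q h => by
    simpa using h
  have hf := tame_softMinNorm (K := K) β hδ Z
  have hρ := tame_smoothNorm (K := K) hδ
  have i1 : Integrable (fun x : J → ℝ => softMinNorm β δ Z fun p => x (Sum.inl (some p)))
      (stdPi J) := ((measurePreserving_comp_injective inj1).integrable_comp
        hf.measurable.aestronglyMeasurable).2 (hf.growth.integrable hf.measurable)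
  have i2 : Integrable (fun x : J → ℝ => smoothNorm δ fun k => x (Sum.inr (Sum.inl k)))
      (stdPi J) := ((measurePreserving_comp_injective inj2).integrable_comp
        hρ.measurable.aestronglyMeasurable).2 (hρ.growth.integrable hρ.measurable)
  have i3 : Integrable (fun x : J → ℝ => W fun l => x (Sum.inr (Sum.inr l)))
      (stdPi J) := ((measurePreserving_comp_injective inj3).integrable_comp
        hWm.aestronglyMeasurable).2 hWi
  have i4 : Integrable (fun x : J → ℝ => x (Sum.inl none)) (stdPi J) :=
    (expGrowth_coord _).integrable (measurable_pi_apply _)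
  have e1 : ∀ x : J → ℝ, softMin β δ (matrixProcess Z *ᵥ x) =
      softMinNorm β δ Z (fun p => x (Sum.inl (some p))) + x (Sum.inl none) := by
    intro x
    refine softMin_add hβ δ _ fun z => ?_
    simp only [blockVal, matrixProcess_mulVec_some, matrixProcess_mulVec_none,
      blockMatrix_mulVec_some, blockMatrix_mulVec_none, add_zero]
  have e2 : ∀ x : J → ℝ, smoothNorm δ (fun k => x (Sum.inr (Sum.inl k))) -
      W (fun l => x (Sum.inr (Sum.inr l))) - Real.log (Fintype.card κ) / β ≤
        softMin β δ (vectorProcess Z *ᵥ x) := by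
    intro x
    refine le_softMin hβ δ _ fun z => ?_
    have := hW z fun l => x (Sum.inr (Sum.inr l))
    simp only [blockVal, vectorProcess_mulVec_some, vectorProcess_mulVec_none]
    linarith
  have hv := (tame_softMin (κ := κ) (K := K) β hδ).comp_mulVec (vectorProcess (K := K) Z)
  have hmono := integral_mono ((i2.sub i3).sub (integrable_const _))
    (hv.growth.integrable hv.measurable) e2
  rw [integral_sub' (i2.sub i3) (integrable_const _), integral_sub' i2 i3] at hmono
  rw [integral_congr_ae (ae_of_all _ e1), integral_add i1 i4, integral_coord, add_zero,
    integral_comp_injective inj1 hf.measurable] at hcomp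
  rw [integral_comp_injective inj2 hρ.measurable, integral_comp_injective inj3 hWm,
    integral_const] at hmono
  simp at hmono
  linarith

end Gordon

section Escape

variable {κ K D : Type*} [Fintype κ] [DecidableEq κ] [Fintype K] [DecidableEq K] [Fintype D]
  [DecidableEq D]

theorem integral_coord_mul_coord (j k : K) :
    ∫ x, x j * x k ∂(stdPi K) = if k = j then 1 else 0 := by
  rw [integral_coord_mul (tame_coord k) j]
  simp only [pd_coord]
  split_ifs <;> simp

theorem integrable_coord_mul_coord (j k : K) :
    Integrable (fun x : K → ℝ => x j * x k) (stdPi K) :=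
  ((tame_coord j).mul (tame_coord k)).growth.integrable
    ((tame_coord j).mul (tame_coord k)).measurable

/-- The lower bound `m / (m + 1)^(1/2)` for the mean of the (smoothed) norm of a standard Gaussian
vector in `ℝᵐ`. -/
theorem integral_smoothNorm_ge {δ : ℝ} (hδ : 0 < δ) :
    (Fintype.card K : ℝ) / Real.sqrt (Fintype.card K + 1) ≤ ∫ v, smoothNorm δ v ∂(stdPi K) := by
  set m : ℝ := (Fintype.card K : ℝ) with hm
  have hm0 : 0 ≤ m := by positivity
  have hρ := tame_smoothNorm (K := K) hδ
  have hρi := tame_inv_smoothNorm (K := K) hδ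
  have iρ := hρ.growth.integrable hρ.measurable
  have T1 : ∀ k : K, Tame fun v : K → ℝ => v k * (v k * smoothNorm δ v) := fun k =>
    (tame_coord k).mul ((tame_coord k).mul hρ)
  have T2 : ∀ k : K, Tame fun v : K → ℝ => v k * (v k * (smoothNorm δ v)⁻¹) := fun k =>
    (tame_coord k).mul ((tame_coord k).mul hρi)
  have i1 := fun k => (T1 k).growth.integrable (T1 k).measurable
  have i2 := fun k => (T2 k).growth.integrable (T2 k).measurable
  have h1 : ∀ k : K, ∫ v, v k * (v k * smoothNorm δ v) ∂(stdPi K) =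
      (∫ v, smoothNorm δ v ∂(stdPi K)) + ∫ v, v k * (v k * (smoothNorm δ v)⁻¹) ∂(stdPi K) := by
    intro k
    rw [integral_coord_mul ((tame_coord k).mul hρ) k, ← integral_add iρ (i2 k)]
    refine integral_congr_ae (ae_of_all _ fun v => ?_)
    simp only
    rw [pd_mul (tame_coord k).diff hρ.diff, pd_coord, pd_smoothNorm hδ]
    simp
  have h2 : ∑ k, ∫ v, v k * (v k * (smoothNorm δ v)⁻¹) ∂(stdPi K) ≤
      ∫ v, smoothNorm δ v ∂(stdPi K) := by
    rw [← integral_finsetSum _ fun k _ => i2 k]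
    refine integral_mono (integrable_finsetSum _ fun k _ => i2 k) iρ fun v => ?_
    have hp := smoothNorm_pos hδ v
    have hs := sq_smoothNorm δ v
    simp only [← mul_assoc, ← Finset.sum_mul, ← pow_two]
    rw [← div_eq_mul_inv, div_le_iff₀ hp]
    nlinarith
  have h3 : ∑ k, ∫ v, v k * (v k * smoothNorm δ v) ∂(stdPi K) ≤
      (m + 1) * ∫ v, smoothNorm δ v ∂(stdPi K) := by
    simp only [h1, Finset.sum_add_distrib]
    simp only [Finset.sum_const, Finset.card_univ, nsmul_eq_mul]
    linarith
  set c := Real.sqrt (m + 1) with hc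
  have hc0 : 0 < c := Real.sqrt_pos.2 (by linarith)
  have hc2 : c ^ 2 = m + 1 := Real.sq_sqrt (by linarith)
  have hpt : ∀ v : K → ℝ, ∑ k, v k * v k ≤
      (c / 2) * smoothNorm δ v + (1 / (2 * c)) * ∑ k, v k * (v k * smoothNorm δ v) := by
    intro v
    have hq : 0 ≤ ∑ k, v k * v k := Finset.sum_nonneg fun k _ => mul_self_nonneg _
    have hs := Real.sq_sqrt hq
    have hs0 := Real.sqrt_nonneg (∑ k, v k * v k)
    set s := Real.sqrt (∑ k, v k * v k)
    have hle : s ≤ smoothNorm δ v := by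
      refine Real.sqrt_le_sqrt ?_
      simp only [pow_two]
      nlinarith
    simp only [← mul_assoc, ← Finset.sum_mul]
    rw [← hs]
    set r := smoothNorm δ v
    have hr0 : 0 ≤ r := hs0.trans hle
    have e : c / 2 * r + 1 / (2 * c) * s ^ 2 * r - s ^ 2 =
        r / (2 * c) * (c - s) ^ 2 + s * (r - s) := by
      field_simp
      ring
    have : 0 ≤ r / (2 * c) * (c - s) ^ 2 + s * (r - s) :=
      add_nonneg (by positivity) (mul_nonneg hs0 (by linarith))
    linarith
  have h4 := integral_mono (integrable_finsetSum Finset.univ fun k _ =>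
      integrable_coord_mul_coord k k)
    ((iρ.const_mul (c / 2)).add
      ((integrable_finsetSum Finset.univ fun k _ => i1 k).const_mul (1 / (2 * c)))) hpt
  rw [integral_finsetSum _ fun k _ => integrable_coord_mul_coord k k] at h4
  simp only [integral_coord_mul_coord, if_true, Finset.sum_const, Finset.card_univ, nsmul_eq_mul,
    mul_one] at h4
  rw [integral_add' (iρ.const_mul _) ((integrable_finsetSum _ fun k _ => i1 k).const_mul _),
    integral_const_mul, integral_const_mul, integral_finsetSum _ fun k _ => i1 k, ← hm] at h4
  have h5 := mul_le_mul_of_nonneg_left h3 (show 0 ≤ 1 / (2 * c) by positivity)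
  rw [← hc2] at h5
  rw [div_le_iff₀ hc0]
  have e : 1 / (2 * c) * (c ^ 2 * ∫ v, smoothNorm δ v ∂(stdPi K)) =
      c / 2 * ∫ v, smoothNorm δ v ∂(stdPi K) := by
    field_simp
  linarith

/-- Escape through a finite mesh: a lower bound for `min ‖M z‖` over finitely many unit vectors. -/
theorem measureReal_exists_norm_le {Z : κ → D → ℝ} (hZ : ∀ z, ∑ l, Z z l ^ 2 = 1)
    {W : (D → ℝ) → ℝ} (hWm : Measurable W) (hWi : Integrable W (stdPi D))
    (hW : ∀ z h, -∑ l, h l * Z z l ≤ W h) {c r : ℝ} (hr : 0 ≤ r)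
    (hc : c + r < (Fintype.card K : ℝ) / Real.sqrt (Fintype.card K + 1) -
      ∫ h, W h ∂(stdPi D)) :
    (stdPi (K × D)).real {M | ∃ z, Real.sqrt (∑ k, (∑ l, M (k, l) * Z z l) ^ 2) ≤ c} ≤
      Real.exp (-r ^ 2 / 2) := by
  rcases isEmpty_or_nonempty κ with hκ | hκ
  · simp [Real.exp_nonneg]
  set gap := (Fintype.card K : ℝ) / Real.sqrt (Fintype.card K + 1) -
      (∫ h, W h ∂(stdPi D)) - (c + r) with hgap
  have hgap0 : 0 < gap := by linarith
  set L := Real.log (Fintype.card κ) with hL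
  have hL0 : 0 ≤ L := Real.log_nonneg (by exact_mod_cast Fintype.card_pos)
  set δ := gap / 2 with hδd
  have hδ : 0 < δ := by positivity
  set β := 2 * (L + 1) / gap with hβd
  have hβ : 0 < β := by positivity
  have hLβ : L / β ≤ gap / 2 := by
    rw [hβd, div_div_eq_mul_div, div_le_div_iff₀ (by positivity) two_pos]
    nlinarith
  have hf := tame_softMinNorm (K := K) β hδ Z
  have hfn : Tame fun M : K × D → ℝ => -1 * softMinNorm β δ Z M := (tame_const (-1)).mul hf
  have hpd : ∀ j, pd j (fun M : K × D → ℝ => -1 * softMinNorm β δ Z M) =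
      fun M => -1 * pd j (softMinNorm β δ Z) M := by
    intro j
    funext M
    rw [pd_mul (tame_const (-1)).diff hf.diff, pd_const]
    ring
  have hconc := measureReal_le_integral_sub_le hfn
    (fun j => by
      rw [hpd]
      exact (tame_const (-1)).mul (tame_pd_softMinNorm hβ hδ Z j))
    (fun M => by
      simp only [hpd, mul_pow]
      simpa using sum_sq_pd_softMinNorm_le hβ hδ hZ M) hr
  refine le_trans (measureReal_mono ?_) hconc
  rintro M ⟨z, hz⟩
  have h1 := integral_softMinNorm_ge (K := K) hβ hδ hZ hWm hWi hW
  have h2 := integral_smoothNorm_ge (K := K) hδ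
  have h3 : softMinNorm β δ Z M ≤ δ + c := by
    refine (softMin_le hβ δ z _).trans ?_
    simp only [blockVal, blockMatrix_mulVec_some, blockMatrix_mulVec_none, add_zero]
    exact (smoothNorm_le hδ _).trans (by linarith)
  simp only [Set.mem_ofPred_eq]
  rw [integral_const_mul]
  linarith

end Escape

theorem integral_abs_gaussianReal_two :
    ∫ t, |t| ∂(gaussianReal 0 2) = 2 / Real.sqrt Real.pi := by
  rw [integral_gaussianReal_eq_integral_smul two_ne_zero]
  let F : ℝ → ℝ := fun s => (Real.sqrt (4 * Real.pi))⁻¹ *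
    (s ^ (1 : ℝ) * Real.exp (-(1 / 4) * s ^ (2 : ℝ)))
  have h1 : ∀ t : ℝ, gaussianPDFReal 0 2 t • |t| = F |t| := by
    intro t
    simp only [F]
    have e : (Real.sqrt (2 * Real.pi * (2 : NNReal)))⁻¹ = (Real.sqrt (4 * Real.pi))⁻¹ := by
      congr 2
      push_cast
      ring
    simp only [gaussianPDFReal, smul_eq_mul, e, Real.rpow_one, Real.rpow_two, sq_abs, sub_zero]
    rw [mul_assoc, mul_comm |t|]
    congr 3
    push_cast
    ring
  refine (integral_congr_ae (ae_of_all _ h1)).trans ((integral_comp_abs (f := F)).trans ?_)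
  simp only [F]
  rw [integral_const_mul, integral_rpow_mul_exp_neg_mul_rpow two_pos (by norm_num) (by norm_num)]
  have hs : Real.sqrt (4 * Real.pi) = 2 * Real.sqrt Real.pi := by
    rw [Real.sqrt_mul (by norm_num), show (4 : ℝ) = 2 ^ 2 by norm_num, Real.sqrt_sq (by norm_num)]
  rw [hs]
  norm_num [Real.rpow_neg_one]
  field_simp

theorem integral_abs_coord_sub {D : Type*} [Fintype D] [DecidableEq D] {i j : D} (h : i ≠ j) :
    ∫ x, |x i - x j| ∂(stdPi D) = 2 / Real.sqrt Real.pi := by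
  have hind : iIndepFun (fun (k : D) (x : D → ℝ) => x k) (stdPi D) :=
    iIndepFun_pi (X := fun _ t => t) fun _ => aemeasurable_id
  have hl : ∀ k : D, HasLaw (fun x : D → ℝ => x k) (gaussianReal 0 1) (stdPi D) := fun k =>
    ⟨(measurable_pi_apply k).aemeasurable,
      (measurePreserving_eval (fun _ : D => gaussianReal 0 1) k).map_eq⟩
  have h1 := gaussianReal_neg (hl j)
  have h2 : IndepFun (fun x : D → ℝ => x i) (-fun x : D → ℝ => x j) (stdPi D) :=
    (hind.indepFun h).comp measurable_id measurable_neg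
  have h3 := gaussianReal_add_gaussianReal_of_indepFun h2 (hl i).map_eq h1.map_eq
  rw [← integral_abs_gaussianReal_two]
  have e : gaussianReal (0 + -0) (1 + 1) = gaussianReal 0 2 := by norm_num
  rw [← e, ← h3, integral_map (by fun_prop) (by fun_prop)]
  simp [sub_eq_add_neg]

section TotalVariation

variable {d : ℕ}

theorem diffOperator_mulVec (v : Fin d → ℝ) (j : Fin (d - 1)) :
    (diffOperator d *ᵥ v) j = v ⟨j + 1, by omega⟩ - v ⟨j, by omega⟩ := by
  have h : ∀ l : Fin d, diffOperator d j l * v l =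
      (if (⟨j + 1, by omega⟩ : Fin d) = l then v l else 0) -
        (if (⟨j, by omega⟩ : Fin d) = l then v l else 0) := by
    intro l
    simp only [diffOperator, Matrix.of_apply, Fin.ext_iff]
    split_ifs <;> first | omega | simp
  simp only [Matrix.mulVec, dotProduct, h, Finset.sum_sub_distrib, Finset.sum_ite_eq,
    Finset.mem_univ, if_true]

theorem sum_abs_diffOperator_col_le (l : Fin d) : ∑ j, |diffOperator d j l| ≤ 2 := by
  have h : ∀ j : Fin (d - 1), |diffOperator d j l| ≤
      (if (l : ℕ) = j then 1 else 0) + (if (l : ℕ) = j + 1 then 1 else 0) := by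
    intro j
    simp only [diffOperator, Matrix.of_apply]
    split_ifs <;> norm_num
  refine (Finset.sum_le_sum fun j _ => h j).trans ?_
  rw [Finset.sum_add_distrib, Finset.sum_boole, Finset.sum_boole]
  have h1 : (Finset.univ.filter fun j : Fin (d - 1) => (l : ℕ) = j).card ≤ 1 :=
    Finset.card_le_one.2 fun a ha b hb => by
      simp only [Finset.mem_filter] at ha hb
      exact Fin.ext (by omega)
  have h2 : (Finset.univ.filter fun j : Fin (d - 1) => (l : ℕ) = j + 1).card ≤ 1 :=
    Finset.card_le_one.2 fun a ha b hb => by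
      simp only [Finset.mem_filter] at ha hb
      exact Fin.ext (by omega)
  have h1' := (Nat.cast_le (α := ℝ)).2 h1
  have h2' := (Nat.cast_le (α := ℝ)).2 h2
  push_cast at h1' h2'
  linarith

theorem sum_sq_transpose_diffOperator_le {c : Fin (d - 1) → ℝ} (hc : ∀ j, |c j| ≤ 1) :
    ∑ l, (∑ j, diffOperator d j l * c j) ^ 2 ≤ 4 * d := by
  have h : ∀ l : Fin d, (∑ j, diffOperator d j l * c j) ^ 2 ≤ 4 := by
    intro l
    have h1 : |∑ j, diffOperator d j l * c j| ≤ 2 := by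
      refine (Finset.abs_sum_le_sum_abs _ _).trans
        ((Finset.sum_le_sum fun j _ => ?_).trans (sum_abs_diffOperator_col_le l))
      rw [abs_mul]
      exact mul_le_of_le_one_right (abs_nonneg _) (hc j)
    rw [← sq_abs]
    nlinarith [abs_nonneg (∑ j, diffOperator d j l * c j)]
  refine (Finset.sum_le_sum fun l _ => h l).trans ?_
  simp [mul_comm]

/-- The directional derivative of the `ℓ₁`-norm at `a` in the direction `b`. -/
noncomputable def l1Deriv {p : ℕ} (a b : Fin p → ℝ) : ℝ :=
  ∑ j, if a j ≠ 0 then Real.sign (a j) * b j else |b j|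

theorem l1Deriv_nonpos {p : ℕ} {a b : Fin p → ℝ} {t : ℝ} (ht : 0 < t)
    (h : l1Norm (a + t • b) ≤ l1Norm a) : l1Deriv a b ≤ 0 := by
  have hpt : ∀ j, t * (if a j ≠ 0 then Real.sign (a j) * b j else |b j|) ≤
      |(a + t • b) j| - |a j| := by
    intro j
    simp only [Pi.add_apply, Pi.smul_apply, smul_eq_mul]
    split_ifs with hj
    · rcases lt_or_gt_of_ne hj with h0 | h0
      · rw [Real.sign_of_neg h0, abs_of_neg h0]
        have := neg_abs_le (a j + t * b j)
        linarith
      · rw [Real.sign_of_pos h0, abs_of_pos h0]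
        have := le_abs_self (a j + t * b j)
        linarith
    · rw [not_not] at hj
      simp [hj, abs_mul, abs_of_pos ht]
  have hs := Finset.sum_le_sum fun j (_ : j ∈ Finset.univ) => hpt j
  rw [← Finset.mul_sum, Finset.sum_sub_distrib] at hs
  simp only [l1Norm] at h
  have : t * l1Deriv a b ≤ 0 := hs.trans (by linarith)
  exact nonpos_of_mul_nonpos_right this ht

/-- An upper bound for the squared distance of `h` from the polar of the descent cone of
the total variation at `x`. -/
noncomputable def widthSq (w : ℝ) (x h : Fin d → ℝ) : ℝ :=
  ∑ l, h l * h l + 2 * w * (∑ j, if (diffOperator d *ᵥ x) j ≠ 0 then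
    Real.sign ((diffOperator d *ᵥ x) j) * (diffOperator d *ᵥ h) j
    else -|(diffOperator d *ᵥ h) j|) + 4 * d * w ^ 2

theorem neg_sum_mul_le_widthSq {w b : ℝ} (hw : 0 ≤ w) (hb : 0 < b) {x z : Fin d → ℝ}
    (hz : ∑ l, z l ^ 2 = 1) (hzd : l1Deriv (diffOperator d *ᵥ x) (diffOperator d *ᵥ z) ≤ 0)
    (h : Fin d → ℝ) : -∑ l, h l * z l ≤ (1 / 2) * (b⁻¹ * widthSq w x h + b) := by
  set c : Fin (d - 1) → ℝ := fun j => if (diffOperator d *ᵥ x) j ≠ 0 then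
    Real.sign ((diffOperator d *ᵥ x) j) else -Real.sign ((diffOperator d *ᵥ h) j) with hc
  have hsign : ∀ y : ℝ, |Real.sign y| ≤ 1 := by
    intro y
    rcases Real.sign_apply_eq y with h | h | h <;> simp [h]
  have hsign2 : ∀ y : ℝ, Real.sign y * y = |y| := by
    intro y
    rcases lt_trichotomy y 0 with h | h | h
    · rw [Real.sign_of_neg h, abs_of_neg h]; ring
    · simp [h]
    · rw [Real.sign_of_pos h, abs_of_pos h]; ring
  have hc1 : ∀ j, |c j| ≤ 1 := by
    intro j
    simp only [hc]
    split_ifs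
    · exact hsign _
    · rw [abs_neg]; exact hsign _
  set u : Fin d → ℝ := fun l => ∑ j, diffOperator d j l * c j with hu
  have hdual : ∀ y : Fin d → ℝ, ∑ l, u l * y l = ∑ j, c j * (diffOperator d *ᵥ y) j := by
    intro y
    simp only [hu, Matrix.mulVec, dotProduct, Finset.sum_mul, Finset.mul_sum]
    rw [Finset.sum_comm]
    exact Finset.sum_congr rfl fun j _ => Finset.sum_congr rfl fun l _ => by ring
  have huz : ∑ l, u l * z l ≤ 0 := by
    rw [hdual]
    refine le_trans (Finset.sum_le_sum fun j _ => ?_) hzd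
    simp only [hc]
    split_ifs
    · exact le_rfl
    · refine (le_abs_self _).trans ?_
      rw [abs_mul, abs_neg]
      exact mul_le_of_le_one_left (abs_nonneg _) (hsign _)
  have huh : ∑ l, u l * h l = ∑ j, if (diffOperator d *ᵥ x) j ≠ 0 then
      Real.sign ((diffOperator d *ᵥ x) j) * (diffOperator d *ᵥ h) j
      else -|(diffOperator d *ᵥ h) j| := by
    rw [hdual]
    refine Finset.sum_congr rfl fun j _ => ?_
    simp only [hc]
    split_ifs
    · rfl
    · rw [neg_mul, hsign2]
  have huu : ∑ l, u l ^ 2 ≤ 4 * d := sum_sq_transpose_diffOperator_le hc1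
  have hcs := Finset.sum_mul_sq_le_sq_mul_sq Finset.univ (fun l => h l + w * u l) z
  rw [hz, mul_one] at hcs
  have e1 : ∑ l, (h l + w * u l) * z l = ∑ l, h l * z l + w * ∑ l, u l * z l := by
    rw [Finset.mul_sum, ← Finset.sum_add_distrib]
    exact Finset.sum_congr rfl fun l _ => by ring
  have e2 : ∑ l, (h l + w * u l) ^ 2 =
      ∑ l, h l * h l + 2 * w * (∑ l, u l * h l) + w ^ 2 * ∑ l, u l ^ 2 := by
    rw [Finset.mul_sum, Finset.mul_sum, ← Finset.sum_add_distrib, ← Finset.sum_add_distrib]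
    exact Finset.sum_congr rfl fun l _ => by ring
  set q := ∑ l, (h l + w * u l) * z l with hq
  have hv : q ^ 2 ≤ widthSq w x h := by
    rw [widthSq, ← huh]
    have := mul_le_mul_of_nonneg_left huu (sq_nonneg w)
    linarith
  have h1 : -∑ l, h l * z l ≤ -q := by
    have := mul_nonpos_of_nonneg_of_nonpos hw huz
    linarith
  have h2 : -q ≤ (1 / 2) * (b⁻¹ * q ^ 2 + b) := by
    have : (1 / 2) * (b⁻¹ * q ^ 2 + b) + q = (1 / 2) * b⁻¹ * (q + b) ^ 2 := by
      field_simp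
      ring
    have h3 : 0 ≤ (1 / 2) * b⁻¹ * (q + b) ^ 2 := by positivity
    linarith
  have h3 : (1 / 2) * (b⁻¹ * q ^ 2 + b) ≤ (1 / 2) * (b⁻¹ * widthSq w x h + b) := by gcongr
  linarith

theorem measurable_widthSq (w : ℝ) (x : Fin d → ℝ) : Measurable (widthSq w x) := by
  unfold widthSq
  refine Continuous.measurable ?_
  refine ((continuous_finsetSum _ fun l _ => by fun_prop).add (continuous_const.mul
    (continuous_finsetSum _ fun j _ => ?_))).add continuous_const
  simp only [diffOperator_mulVec _ j]
  split_ifs <;> fun_prop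

theorem integrable_and_integral_widthSq (w : ℝ) (x : Fin d → ℝ) :
    Integrable (widthSq w x) (stdPi (Fin d)) ∧ ∫ h, widthSq w x h ∂(stdPi (Fin d)) =
      d - 4 * w / Real.sqrt Real.pi *
        (Finset.univ.filter fun j => (diffOperator d *ᵥ x) j = 0).card + 4 * d * w ^ 2 := by
  have ic : ∀ l : Fin d, Integrable (fun h : Fin d → ℝ => h l) (stdPi (Fin d)) := fun l =>
    (expGrowth_coord l).integrable (measurable_pi_apply l)
  have hT : ∀ j : Fin (d - 1), Integrable (fun h : Fin d → ℝ =>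
      if (diffOperator d *ᵥ x) j ≠ 0 then
        Real.sign ((diffOperator d *ᵥ x) j) * (diffOperator d *ᵥ h) j
        else -|(diffOperator d *ᵥ h) j|) (stdPi (Fin d)) ∧
      ∫ h, (if (diffOperator d *ᵥ x) j ≠ 0 then
        Real.sign ((diffOperator d *ᵥ x) j) * (diffOperator d *ᵥ h) j
        else -|(diffOperator d *ᵥ h) j|) ∂(stdPi (Fin d)) =
      (-2 / Real.sqrt Real.pi) * if (diffOperator d *ᵥ x) j = 0 then 1 else 0 := by
    intro j
    simp only [diffOperator_mulVec _ j]
    by_cases hj : x ⟨j + 1, by omega⟩ - x ⟨j, by omega⟩ = 0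
    · simp only [hj, ne_eq, not_true_eq_false, if_false, if_true]
      refine ⟨((ic _).sub (ic _)).abs.neg, ?_⟩
      rw [integral_neg, integral_abs_coord_sub (by simp [Fin.ext_iff])]
      ring
    · simp only [hj, ne_eq, not_false_eq_true, if_false, if_true]
      refine ⟨((ic _).sub (ic _)).const_mul _, ?_⟩
      rw [integral_const_mul, integral_sub (ic _) (ic _), integral_coord, integral_coord]
      simp
  have i1 : Integrable (fun h : Fin d → ℝ => ∑ l, h l * h l) (stdPi (Fin d)) :=
    integrable_finsetSum _ fun l _ => integrable_coord_mul_coord l l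
  have i2 := (integrable_finsetSum Finset.univ fun j _ => (hT j).1).const_mul (2 * w)
  have i3 : Integrable (fun _ : Fin d → ℝ => 4 * (d : ℝ) * w ^ 2) (stdPi (Fin d)) :=
    integrable_const _
  refine ⟨(i1.add i2).add i3, ?_⟩
  have e := integral_add' (i1.add i2) i3
  rw [integral_add' i1 i2, integral_const_mul, integral_finsetSum _ fun j _ => (hT j).1,
    integral_finsetSum _ fun l _ => integrable_coord_mul_coord l l] at e
  refine e.trans ?_
  simp only [fun j => (hT j).2, ← Finset.mul_sum, Finset.sum_boole, integral_coord_mul_coord]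
  simp
  ring

end TotalVariation

section Mesh

variable {K D : Type*} [Fintype K] [DecidableEq K] [Fintype D] [DecidableEq D]

/-- The Euclidean norm of `M z`, where the matrix `M` is given by its entries. -/
noncomputable def mulNorm (M : K × D → ℝ) (z : D → ℝ) : ℝ :=
  Real.sqrt (∑ k, (∑ l, M (k, l) * z l) ^ 2)

theorem continuous_mulNorm_left (z : D → ℝ) : Continuous fun M : K × D → ℝ => mulNorm M z := by
  unfold mulNorm
  fun_prop

theorem continuous_mulNorm_right (M : K × D → ℝ) : Continuous (mulNorm M) := by
  unfold mulNorm
  fun_prop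

/-- Gordon's escape through a mesh: a Gaussian matrix is bounded below on a subset of the sphere. -/
theorem measure_exists_mulNorm_lt {T : Set (D → ℝ)} (hT : ∀ z ∈ T, ∑ l, z l ^ 2 = 1)
    {W : (D → ℝ) → ℝ} (hWm : Measurable W) (hWi : Integrable W (stdPi D))
    (hW : ∀ z ∈ T, ∀ h, -∑ l, h l * z l ≤ W h) {c r : ℝ} (hr : 0 ≤ r)
    (hc : c + r ≤ (Fintype.card K : ℝ) / Real.sqrt (Fintype.card K + 1) -
      ∫ h, W h ∂(stdPi D)) :
    stdPi (K × D) {M | ∃ z ∈ T, mulNorm M z < c} ≤ ENNReal.ofReal (Real.exp (-r ^ 2 / 2)) := by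
  rcases T.eq_empty_or_nonempty with rfl | hne
  · simp
  have : Nonempty T := hne.to_subtype
  set u : ℕ → T := TopologicalSpace.denseSeq T with hu
  set s : ℕ → Set (K × D → ℝ) := fun n =>
    {M | ∃ i : Fin (n + 1), mulNorm M (u i) ≤ c - 1 / (n + 1 : ℝ)} with hs
  have hmono : Monotone s := by
    intro n n' hn M
    rintro ⟨i, hi⟩
    refine ⟨⟨i, by omega⟩, hi.trans ?_⟩
    have : (n : ℝ) ≤ n' := by exact_mod_cast hn
    gcongr
  have hsub : {M : K × D → ℝ | ∃ z ∈ T, mulNorm M z < c} ⊆ ⋃ n, s n := by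
    rintro M ⟨z, hz, hzc⟩
    have hopen : IsOpen {y : T | mulNorm M y < c} :=
      isOpen_lt ((continuous_mulNorm_right M).comp continuous_subtype_val) continuous_const
    obtain ⟨i, hi⟩ := (TopologicalSpace.denseRange_denseSeq T).exists_mem_open hopen ⟨⟨z, hz⟩, hzc⟩
    have hi' : 0 < c - mulNorm M (TopologicalSpace.denseSeq T i) := sub_pos.2 hi
    obtain ⟨k, hk⟩ := exists_nat_one_div_lt hi'
    refine Set.mem_iUnion.2 ⟨max i k, ⟨⟨i, by omega⟩, ?_⟩⟩
    have h1 : (k : ℝ) ≤ (max i k : ℕ) := by exact_mod_cast le_max_right i k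
    have h2 : 1 / ((max i k : ℕ) + 1 : ℝ) ≤ 1 / (k + 1) := by gcongr
    change mulNorm M (TopologicalSpace.denseSeq T i) ≤ _
    linarith
  refine (measure_mono hsub).trans ?_
  rw [hmono.measure_iUnion]
  refine iSup_le fun n => ?_
  have hn : (0 : ℝ) < 1 / (n + 1 : ℝ) := by positivity
  have := measureReal_exists_norm_le (K := K) (Z := fun (i : Fin (n + 1)) l => (u i : D → ℝ) l)
    (fun i => hT _ (u i).2) hWm hWi (fun i h => hW _ (u i).2 h) (c := c - 1 / (n + 1 : ℝ)) hr
    (by linarith)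
  rw [← ofReal_measureReal]
  exact ENNReal.ofReal_le_ofReal this

end Mesh

section Recovery

variable {m d : ℕ}

/-- The unit vectors in the descent directions of the total variation at `x`. -/
def descentSphere (x : Fin d → ℝ) : Set (Fin d → ℝ) :=
  {z | ∑ l, z l ^ 2 = 1 ∧ l1Deriv (diffOperator d *ᵥ x) (diffOperator d *ᵥ z) ≤ 0}

theorem mulNorm_eq (M : Matrix (Fin m) (Fin d) ℝ) (z : EuclideanSpace ℝ (Fin d)) :
    mulNorm (fun ij : Fin m × Fin d => M ij.1 ij.2) z.ofLp = ‖applyMatrix M z‖ := by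
  simp [mulNorm, applyMatrix, EuclideanSpace.norm_eq, Matrix.mulVec, dotProduct]

theorem applyMatrix_sub (M : Matrix (Fin m) (Fin d) ℝ) (y z : EuclideanSpace ℝ (Fin d)) :
    applyMatrix M (y - z) = applyMatrix M y - applyMatrix M z := by
  simp [applyMatrix, Matrix.mulVec_sub]

theorem applyMatrix_smul (M : Matrix (Fin m) (Fin d) ℝ) (t : ℝ) (z : EuclideanSpace ℝ (Fin d)) :
    applyMatrix M (t • z) = t • applyMatrix M z := by
  simp [applyMatrix, Matrix.mulVec_smul]

/-- Robust recovery from a lower bound for the matrix on the descent directions. -/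
theorem norm_sub_le_of_minimizer {M : Matrix (Fin m) (Fin d) ℝ} {x : EuclideanSpace ℝ (Fin d)}
    {τ η : ℝ} (hτ : 0 < τ) (hM : ∀ z ∈ descentSphere x.ofLp,
      τ ≤ mulNorm (fun ij : Fin m × Fin d => M ij.1 ij.2) z)
    {w : EuclideanSpace ℝ (Fin m)} (hw : ‖w‖ ≤ η) {xhat : EuclideanSpace ℝ (Fin d)}
    (hxhat : IsAnalysisL1Minimizer (diffOperator d) M (applyMatrix M x + w) η xhat) :
    ‖x - xhat‖ ≤ 2 * η / τ := by
  have hη : 0 ≤ η := (norm_nonneg w).trans hw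
  rcases eq_or_ne xhat x with rfl | hne
  · rw [sub_self, norm_zero]
    positivity
  have hz : 0 < ‖xhat - x‖ := norm_pos_iff.2 (sub_ne_zero.2 hne)
  set t := ‖xhat - x‖ with ht
  set z : EuclideanSpace ℝ (Fin d) := t⁻¹ • (xhat - x) with hzd
  have hznorm : ‖z‖ = 1 := by
    rw [hzd, norm_smul, norm_inv, norm_norm, inv_mul_cancel₀ hz.ne']
  have hxz : x + t • z = xhat := by
    rw [hzd, smul_smul, mul_inv_cancel₀ hz.ne', one_smul, add_sub_cancel]
  obtain ⟨hfeas, hmin⟩ := hxhat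
  have hxfeas : x ∈ feasibleSet M (applyMatrix M x + w) η := by
    simpa [feasibleSet] using hw
  have hmem : z.ofLp ∈ descentSphere x.ofLp := by
    constructor
    · have := EuclideanSpace.real_norm_sq_eq z
      rw [hznorm] at this
      rw [← this, one_pow]
    · refine l1Deriv_nonpos hz ?_
      have h := hmin hxfeas
      simp only [Set.mem_ofPred_eq] at h
      rw [← hxz] at h
      simpa [Matrix.mulVec_add, Matrix.mulVec_smul] using h
  have h1 := hM _ hmem
  rw [mulNorm_eq, hzd, applyMatrix_smul, norm_smul, norm_inv, norm_norm, applyMatrix_sub] at h1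
  have h2 : ‖applyMatrix M xhat - applyMatrix M x‖ ≤ 2 * η := by
    have h3 : ‖applyMatrix M xhat - (applyMatrix M x + w)‖ ≤ η := hfeas
    have h4 : applyMatrix M xhat - applyMatrix M x =
        (applyMatrix M xhat - (applyMatrix M x + w)) + w := by abel
    rw [h4]
    refine (norm_add_le _ _).trans ?_
    linarith
  rw [norm_sub_rev, ← ht, le_div_iff₀ hτ]
  rw [inv_mul_eq_div, le_div_iff₀ hz] at h1
  linarith

end Recovery

theorem aemeasurable_entries {Ω : Type*} [MeasurableSpace Ω] {P : Measure Ω} {m d : ℕ}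
    {M : Ω → Matrix (Fin m) (Fin d) ℝ} (hM : IsGaussianMatrix P M) :
    AEMeasurable (fun ω (ij : Fin m × Fin d) => M ω ij.1 ij.2) P :=
  aemeasurable_pi_lambda _ fun ij => (hM.1 ij.1 ij.2).aemeasurable

theorem map_entries {Ω : Type*} [MeasurableSpace Ω] {P : Measure Ω} [IsProbabilityMeasure P]
    {m d : ℕ} {M : Ω → Matrix (Fin m) (Fin d) ℝ} (hM : IsGaussianMatrix P M) :
    P.map (fun ω (ij : Fin m × Fin d) => M ω ij.1 ij.2) = stdPi (Fin m × Fin d) := by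
  refine ((iIndepFun_iff_map_fun_eq_pi_map
    fun ij : Fin m × Fin d => (hM.1 ij.1 ij.2).aemeasurable).1 hM.2).trans ?_
  congr 1
  funext ij
  exact (hM.1 ij.1 ij.2).map_eq

theorem card_filter_eq_of_isCosparse {p d : ℕ} {A : Matrix (Fin p) (Fin d) ℝ} {ℓ : ℕ}
    {x : EuclideanSpace ℝ (Fin d)} (hx : IsCosparse A ℓ x) :
    (Finset.univ.filter fun j => (A *ᵥ x.ofLp) j = 0).card = ℓ := by
  have h1 := Finset.card_filter_add_card_filter_not (s := (Finset.univ : Finset (Fin p)))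
    (fun j => (A *ᵥ x.ofLp) j = 0)
  have h2 : {j : Fin p | (A *ᵥ x.ofLp) j ≠ 0}.ncard =
      (Finset.univ.filter fun j => ¬ (A *ᵥ x.ofLp) j = 0).card := by
    rw [← Set.ncard_coe_finset]
    congr 1
    ext j
    simp
  rw [IsCosparse, h2] at hx
  rw [Finset.card_univ, Fintype.card_fin] at h1
  omega

/-- The bound for the mean width of the descent directions of the total variation. -/
theorem exists_width_bound {d ℓ : ℕ} (hd : 1 ≤ d) {x : EuclideanSpace ℝ (Fin d)}
    (hx : IsCosparse (diffOperator d) ℓ x) {b : ℝ} (hb : 0 < b)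
    (hb2 : b ^ 2 = d - ℓ ^ 2 / (Real.pi * d)) :
    ∃ W : (Fin d → ℝ) → ℝ, Measurable W ∧ Integrable W (stdPi (Fin d)) ∧
      (∀ z ∈ descentSphere x.ofLp, ∀ h, -∑ l, h l * z l ≤ W h) ∧
      ∫ h, W h ∂(stdPi (Fin d)) = b := by
  have hd0 : (0 : ℝ) < d := by exact_mod_cast hd
  set w : ℝ := ℓ / (2 * d * Real.sqrt Real.pi) with hw
  have hw0 : 0 ≤ w := by positivity
  obtain ⟨hi, he⟩ := integrable_and_integral_widthSq w x.ofLp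
  rw [card_filter_eq_of_isCosparse hx] at he
  refine ⟨fun h => (1 / 2) * (b⁻¹ * widthSq w x.ofLp h + b),
    (((measurable_widthSq w x.ofLp).const_mul _).add_const _).const_mul _,
    ((hi.const_mul _).add (integrable_const _)).const_mul _,
    fun z hz h => neg_sum_mul_le_widthSq hw0 hb hz.1 hz.2 h, ?_⟩
  rw [integral_const_mul, integral_add (hi.const_mul _) (integrable_const _), integral_const_mul,
    he]
  have hv : (d : ℝ) - 4 * w / Real.sqrt Real.pi * ℓ + 4 * d * w ^ 2 = b ^ 2 := by
    have hp : Real.sqrt Real.pi ^ 2 = Real.pi := Real.sq_sqrt Real.pi_pos.le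
    have hp0 : 0 < Real.sqrt Real.pi := Real.sqrt_pos.2 Real.pi_pos
    rw [hb2, hw]
    generalize Real.sqrt Real.pi = p at hp hp0
    rw [← hp]
    field_simp
    ring
  rw [hv]
  simp
  field_simp
  ring

end GaussianTools

open GaussianTools in
/-- Nonuniform robust recovery by one-dimensional total variation minimization from Gaussian
measurements. The event `E` depends on the matrix only; the noise `w` is arbitrary and may depend on
the draw of the matrix. -/
theorem mainTheorem2 {Ω : Type*} [MeasurableSpace Ω] (P : Measure Ω) [IsProbabilityMeasure P]
    (m d ℓ s : ℕ) (hd : 1 ≤ d) (x : EuclideanSpace ℝ (Fin d))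
    (hx : IsCosparse (diffOperator d) ℓ x) (hs : s = d - 1 - ℓ)
    (M : Ω → Matrix (Fin m) (Fin d) ℝ) (hM : IsGaussianMatrix P M)
    (η τ ε : ℝ) (hτ : 0 < τ) (hε0 : 0 < ε) (hε1 : ε < 1)
    (hm : (m : ℝ) ^ 2 / ((m : ℝ) + 1) ≥
      (Real.sqrt ((d : ℝ) * (1 - 1 / Real.pi * (1 - ((s : ℝ) + 1) / (d : ℝ)) ^ 2))
        + Real.sqrt (2 * Real.log ε⁻¹) + τ) ^ 2) :
    ∃ E : Set Ω, MeasurableSet E ∧ ENNReal.ofReal (1 - ε) ≤ P E ∧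
      ∀ ω ∈ E, ∀ w : EuclideanSpace ℝ (Fin m), ‖w‖ ≤ η →
        ∀ xhat : EuclideanSpace ℝ (Fin d),
          IsAnalysisL1Minimizer (diffOperator d) (M ω) (applyMatrix (M ω) x + w) η xhat →
            ‖x - xhat‖ ≤ 2 * η / τ := by
  have hd0 : (0 : ℝ) < d := by exact_mod_cast hd
  have hℓ : ℓ ≤ d - 1 := by
    rw [IsCosparse] at hx
    omega
  have hsd : s + 1 + ℓ = d := by omega
  have hsd' : (s : ℝ) + 1 + ℓ = d := by exact_mod_cast hsd
  set b := Real.sqrt ((d : ℝ) * (1 - 1 / Real.pi * (1 - ((s : ℝ) + 1) / (d : ℝ)) ^ 2)) with hb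
  set r := Real.sqrt (2 * Real.log ε⁻¹) with hr
  have hfrac : 1 - ((s : ℝ) + 1) / d = ℓ / d := by
    field_simp
    linarith
  have hpos : 0 < (d : ℝ) * (1 - 1 / Real.pi * (1 - ((s : ℝ) + 1) / (d : ℝ)) ^ 2) := by
    rw [hfrac]
    have h1 : (ℓ : ℝ) / d ≤ 1 := (div_le_one hd0).2 (by linarith [s.cast_nonneg (α := ℝ)])
    have h2 : ((ℓ : ℝ) / d) ^ 2 ≤ 1 := pow_le_one₀ (by positivity) h1
    have h3 : 1 / Real.pi < 1 := by
      rw [div_lt_one Real.pi_pos]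
      linarith [Real.pi_gt_three]
    have h4 : 1 / Real.pi * ((ℓ : ℝ) / d) ^ 2 ≤ 1 / Real.pi :=
      mul_le_of_le_one_right (by positivity) h2
    exact mul_pos hd0 (by linarith)
  have hb0 : 0 < b := Real.sqrt_pos.2 hpos
  have hb2 : b ^ 2 = d - ℓ ^ 2 / (Real.pi * d) := by
    rw [hb, Real.sq_sqrt hpos.le, hfrac]
    have := Real.pi_pos.ne'
    field_simp
  have hr0 : 0 ≤ r := Real.sqrt_nonneg _
  have hrε : Real.exp (-r ^ 2 / 2) = ε := by
    have hlog : 0 ≤ Real.log ε⁻¹ := Real.log_nonneg ((one_le_inv₀ hε0).2 hε1.le)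
    rw [hr, Real.sq_sqrt (by positivity), Real.log_inv]
    rw [show -(2 * -Real.log ε) / 2 = Real.log ε by ring, Real.exp_log hε0]
  obtain ⟨W, hWm, hWi, hW, hWe⟩ := exists_width_bound hd hx hb0 hb2
  have hbound : τ + r ≤ (Fintype.card (Fin m) : ℝ) / Real.sqrt (Fintype.card (Fin m) + 1) -
      ∫ h, W h ∂(stdPi (Fin d)) := by
    rw [Fintype.card_fin, hWe]
    have h1 : (b + r + τ) ^ 2 ≤ ((m : ℝ) / Real.sqrt (m + 1)) ^ 2 := by
      rw [div_pow, Real.sq_sqrt (by positivity)]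
      exact hm
    have h2 := le_of_sq_le_sq h1 (by positivity)
    linarith
  have hmesh := measure_exists_mulNorm_lt (K := Fin m) (fun z hz => hz.1) hWm hWi hW hr0 hbound
  rw [hrε] at hmesh
  set B : Set (Fin m × Fin d → ℝ) := {A | ∃ z ∈ descentSphere x.ofLp, mulNorm A z < τ} with hB
  have hBm : MeasurableSet B := by
    have : B = ⋃ z ∈ descentSphere x.ofLp, {A | mulNorm A z < τ} := by
      ext A
      simp [hB]
    rw [this]
    exact (isOpen_biUnion fun z _ =>
      isOpen_lt (continuous_mulNorm_left z) continuous_const).measurableSet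
  obtain ⟨E, hEsub, hEm, hEae⟩ :=
    ((aemeasurable_entries hM).nullMeasurableSet_preimage hBm.compl).exists_measurable_subset_ae_eq
  refine ⟨E, hEm, ?_, fun ω hω w hw xhat hxhat => ?_⟩
  · rw [measure_congr hEae, ← Measure.map_apply_of_aemeasurable (aemeasurable_entries hM) hBm.compl,
      map_entries hM, prob_compl_eq_one_sub hBm, ENNReal.ofReal_sub _ hε0.le, ENNReal.ofReal_one]
    exact tsub_le_tsub_left hmesh 1
  · refine norm_sub_le_of_minimizer hτ (fun z hz => ?_) hw hxhat
    by_contra hlt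
    exact hEsub hω ⟨z, hz, not_le.1 hlt⟩
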